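/- Let $(G,\Omega)$ be an oligomorphic group, i.e. a group $G$ of permutations of a set $\Omega$ such that $G$ has finitely many orbits on $\Omega^n$ for every $n\ge 0$. For a finite subset $A\subset\Omega$ let $G(A)$ and $G[A]$ be the pointwise and the setwise stabilizer of $A$ in $G$, and let $\mathscr{E}=\mathscr{E}(\Omega)$ be the collection of all subgroups $G(A)$ with $A\subset\Omega$ finite. An $\mathscr{E}$-smooth $G$-set is a set with an action of $G$ that has finitely many orbits and such that the stabilizer of every element belongs to $\mathscr{E}$; a transitive $G$-set is one with exactly one orbit. Let $\Theta(G,\Omega)=P/I$, where $P$ is the polynomial ring over $\mathbf{Z}$ in symbols $[f]$, one for each $G$-equivariant map $f\colon Y\to X$ of $\mathscr{E}$-smooth $G$-sets with $X$ transitive, and $I$ is the ideal generated by the following relations: (a) $[f]=1$ if $f$ is an isomorphism; (b) $[f]=[f|_{Y_1}]+[f|_{Y_2}]$ if $f\colon Y\to X$ is as above and $Y=Y_1\sqcup Y_2$ as $G$-sets; (c) $[f\circ g]=[f]\,[g]$ for maps $g\colon Z\to Y$ and $f\colon Y\to X$ of transitive $\mathscr{E}$-smooth $G$-sets; (d) $[f]=[f']$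 if $f\colon Y\to X$ and $X'\to X$ are maps of $\mathscr{E}$-smooth $G$-sets with $X$ and $X'$ transitive, and $f'\colon Y'\to X'$ is the base change of $f$. Let $m$ be a positive integer, and suppose that $\mathrm{IND}(m)$ holds: for every finite $A\subset\Omega$, the index of $G(A)$ in $G[A]$ divides a power of $m$. Then $\Theta(G,\Omega)[1/m]$ is a binomial ring; that is, it is $\mathbf{Z}$-torsion free, and for every element $x$ and every $n\in\mathbf{N}$ the element $\binom{x}{n}=\frac{x(x-1)\cdots(x-n+1)}{n!}$ of $\Theta(G,\Omega)[1/m]\otimes\mathbf{Q}$ belongs to $\Theta(G,\Omega)[1/m]$. -/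

import Mathlib

open scoped Pointwise

universe u

/-- The action of `G` on `Ω` is oligomorphic: `G` has finitely many orbits on `Ω ^ n` (with the
diagonal action) for every `n`. An oligomorphic group is a permutation group `(G, Ω)`, i.e. a group
with a faithful action, which has this property. -/
def IsOligomorphic (G Ω : Type u) [Group G] [MulAction G Ω] : Prop :=
  ∀ n : ℕ, Finite (MulAction.orbitRel.Quotient G (Fin n → Ω))

/-- The class `𝓔(Ω)` of all subgroups `G(A)`, the pointwise stabilizers of the finite subsets `A`
of `Ω`. -/
def pointStabilizerClass (G Ω : Type u) [Group G] [MulAction G Ω] : Set (Subgroup G) :=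
  {U | ∃ A : Finset Ω, U = fixingSubgroup G (A : Set Ω)}

/-- The condition `IND(m)`: for every finite `A ⊆ Ω`, the index of the pointwise stabilizer `G(A)`
in the setwise stabilizer `G[A]` divides a power of `m`. -/
def SatisfiesIND (G Ω : Type u) [Group G] [MulAction G Ω] (m : ℕ) : Prop :=
  ∀ A : Finset Ω, ∃ k : ℕ,
    (fixingSubgroup G (A : Set Ω)).relIndex (MulAction.stabilizer G (A : Set Ω)) ∣ m ^ k

/-- An `𝓔`-smooth `G`-set: a set with an action of `G` which is finitary (there are finitely many
orbits) and such that the stabilizer of every element belongs to `𝓔`. As the orbits are quotients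
of `G`, every such set is isomorphic to one in the universe of `G`. -/
structure SmoothGSet (G : Type u) [Group G] (𝓔 : Set (Subgroup G)) : Type (u + 1) where
  carrier : Type u
  [action : MulAction G carrier]
  finitary : Finite (MulAction.orbitRel.Quotient G carrier)
  smooth : ∀ x : carrier, MulAction.stabilizer G x ∈ 𝓔

namespace SmoothGSet

variable {G : Type u} [Group G] {𝓔 : Set (Subgroup G)}

instance : CoeSort (SmoothGSet G 𝓔) (Type u) := ⟨SmoothGSet.carrier⟩

instance (X : SmoothGSet G 𝓔) : MulAction G X := X.action

/-- A `G`-set is transitive if it consists of exactly one orbit (in particular, it is nonempty). -/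
def IsTransitive (X : SmoothGSet G 𝓔) : Prop :=
  Nonempty X ∧ MulAction.IsPretransitive G X

end SmoothGSet

/-- A `G`-equivariant map `f : Y → X` of `𝓔`-smooth `G`-sets, with `X` transitive. -/
structure MapToTransitive (G : Type u) [Group G] (𝓔 : Set (Subgroup G)) : Type (u + 1) where
  {source : SmoothGSet G 𝓔}
  {target : SmoothGSet G 𝓔}
  transitive : target.IsTransitive
  map : source →[G] target

/-- The variable `[f]` of the polynomial ring on all maps `f : Y → X` of `𝓔`-smooth `G`-sets with
`X` transitive. -/
noncomputable def mapSymbol {G : Type u} [Group G] {𝓔 : Set (Subgroup G)}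
    {Y X : SmoothGSet G 𝓔} (hX : X.IsTransitive) (f : Y →[G] X) :
    MvPolynomial (MapToTransitive G 𝓔) ℤ :=
  MvPolynomial.X ⟨hX, f⟩

/-- The defining relations of `Θ(G, 𝓔)`; each listed polynomial is to become zero. -/
inductive IsThetaRelation {G : Type u} [Group G] {𝓔 : Set (Subgroup G)} :
    MvPolynomial (MapToTransitive G 𝓔) ℤ → Prop
  /-- `[f] = 1` if `f` is an isomorphism. -/
  | iso {Y X : SmoothGSet G 𝓔} (hX : X.IsTransitive) (f : Y →[G] X)
      (hf : Function.Bijective f) :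
      IsThetaRelation (mapSymbol hX f - 1)
  /-- `[f] = [f₁] + [f₂]` if `Y` is the disjoint union of `Y₁` and `Y₂` (embedded by `i₁` and
  `i₂`), where `f₁` and `f₂` are the restrictions of `f`. -/
  | add {Y Y₁ Y₂ X : SmoothGSet G 𝓔} (hX : X.IsTransitive) (f : Y →[G] X)
      (i₁ : Y₁ →[G] Y) (i₂ : Y₂ →[G] Y)
      (h : Function.Bijective (Sum.elim i₁ i₂)) :
      IsThetaRelation
        (mapSymbol hX f - (mapSymbol hX (f.comp i₁) + mapSymbol hX (f.comp i₂)))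
  /-- `[f ∘ g] = [f] [g]` for maps `g : Z → Y` and `f : Y → X` of transitive sets. -/
  | comp {Z Y X : SmoothGSet G 𝓔} (_ : Z.IsTransitive) (hY : Y.IsTransitive)
      (hX : X.IsTransitive) (f : Y →[G] X) (g : Z →[G] Y) :
      IsThetaRelation (mapSymbol hX (f.comp g) - mapSymbol hX f * mapSymbol hY g)
  /-- `[f] = [f']` if `f' : Y' → X'` is the base change of `f : Y → X` along a map `g : X' → X`
  of transitive sets, i.e. there is a map `g' : Y' → Y` with `f ∘ g' = g ∘ f'` that identifies
  `Y'` with the fiber product of `Y` and `X'` over `X`. -/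
  | baseChange {Y X Y' X' : SmoothGSet G 𝓔} (hX : X.IsTransitive) (hX' : X'.IsTransitive)
      (f : Y →[G] X) (g : X' →[G] X) (f' : Y' →[G] X') (g' : Y' →[G] Y)
      (comm : ∀ y' : Y', f (g' y') = g (f' y'))
      (cartesian : ∀ (y : Y) (x' : X'), f y = g x' → ∃! y' : Y', g' y' = y ∧ f' y' = x') :
      IsThetaRelation (mapSymbol hX f - mapSymbol hX' f')

/-- The ring `Θ(G, 𝓔)`: the polynomial ring over `ℤ` in the symbols `[f]`, modulo the ideal
generated by the defining relations. It carries the universal measure for `(G, 𝓔)`. -/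
abbrev Theta (G : Type u) [Group G] (𝓔 : Set (Subgroup G)) : Type (u + 1) :=
  MvPolynomial (MapToTransitive G 𝓔) ℤ ⧸
    Ideal.span {p : MvPolynomial (MapToTransitive G 𝓔) ℤ | IsThetaRelation p}

/-- The ring `Θ(G, Ω) = Θ(G, 𝓔(Ω))`. -/
abbrev ThetaPerm (G Ω : Type u) [Group G] [MulAction G Ω] : Type (u + 1) :=
  Theta G (pointStabilizerClass G Ω)

/-! Write `P` for the polynomial ring, `I` for the relation ideal, and fix a prime `p` not dividing
`m`. A torsion-free ring in which `x ^ p ≡ x` modulo every prime is binomial, and primes dividing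
`m` become units after localization, so it suffices that `P ⧸ I` has no `p`-torsion and satisfies `x
^ p ≡ x` mod `p` (`nonempty_binomialRing_away`).

The `p`-fold fiber power of `f : Y → X` over `X` splits into the diagonal, a copy of `Y`, and the
nonconstant tuples, on which `ZMod p` acts by rotation. `IND(m)` says that this rotation is free
even modulo `G` (`isConstTuple_of_satisfiesIND`), so the nonconstant tuples are `p` rotated copies
of a `G`-invariant domain `D`. Hence `[f] ^ p = [f] + p [D]` in the quotient (`thetaClass_pow_eq`).

Torsion needs more. Setting `φ [f] = [f] ^ p - p [D]` defines a lift of Frobenius on `P` that is the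
identity modulo `I`. Geometric formulas for `[D]` under each kind of relation give `φ s - s ^ p ∈ p
I` for every generator `s`, hence for every `s ∈ I`. If `p x ∈ I`, dividing `φ (p x) - (p x) ^ p ∈ p
I` by `p` yields `φ x ∈ I`, and so `x ∈ I` (`dvd_sub_and_torsionFree_of_frobenius_lift`). -/

/-! ### Binomial rings from Frobenius congruences, and Frobenius lifts on quotients. -/

section Algebra

/-- After localizing at `M`, the maximal ideal is generated by `p` and the residue field is the
prime field, so every element has a `p`-adic expansion with integer digits. The element `s` is the
denominator that avoids localizing. -/
theorem exists_notMem_mul_sub_intCast {R : Type*} [CommRing R] {p : ℕ} (hp : p.Prime)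
    (hfrob : ∀ x : R, (p : R) ∣ x ^ p - x) (M : Ideal R) [hM : M.IsMaximal] (hpM : (p : R) ∈ M)
    (x : R) (N : ℕ) : ∃ s ∉ M, ∃ a : ℤ, (p : R) ^ N ∣ s * (x - a) := by
  have hlocal : ∀ y ∈ M, ∃ s ∉ M, (p : R) ∣ s * y := by
    intro y hy
    refine ⟨y ^ (p - 1) - 1, fun h => ?_, ?_⟩
    · have h1 : y ^ (p - 1) ∈ M :=
        Ideal.pow_mem_of_mem M hy _ (Nat.sub_pos_of_lt hp.one_lt)
      exact hM.ne_top ((Ideal.eq_top_iff_one _).2 (by simpa using M.sub_mem h1 h))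
    · have : (y ^ (p - 1) - 1) * y = y ^ p - y := by
        rw [sub_mul, one_mul, pow_sub_one_mul hp.ne_zero]
      exact this ▸ hfrob y
  have hres : ∀ y : R, ∃ b : ℤ, y - b ∈ M := by
    let := Ideal.Quotient.field M
    have : Fact p.Prime := ⟨hp⟩
    have : CharP (R ⧸ M) p := by
      refine (CharP.charP_iff_prime_eq_zero hp).2 ?_
      rw [← map_natCast (Ideal.Quotient.mk M)]
      exact Ideal.Quotient.eq_zero_iff_mem.2 hpM
    intro y
    have hy : (Ideal.Quotient.mk M y) ^ p = Ideal.Quotient.mk M y := by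
      rw [← map_pow, Ideal.Quotient.mk_eq_mk_iff_sub_mem]
      exact M.mem_of_dvd (hfrob y) hpM
    have hy' : Ideal.Quotient.mk M y ∈ (⊥ : Subfield (R ⧸ M)) := by
      rw [Subfield.mem_bot_iff_pow_eq_self (F := R ⧸ M) (p := p)]
      exact hy
    obtain ⟨z, hz⟩ := (mem_bot_iff_intCast p (R ⧸ M)).1 hy'
    refine ⟨z, ?_⟩
    rw [← Ideal.Quotient.mk_eq_mk_iff_sub_mem, ← hz, map_intCast]
  induction N with
  | zero => exact ⟨1, (Ideal.ne_top_iff_one M).1 hM.ne_top, 0, by simp⟩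
  | succ N ih =>
    obtain ⟨s, hs, a, z, hz⟩ := ih
    obtain ⟨w, hw⟩ := Ideal.Quotient.exists_inv (I := M)
      (a := Ideal.Quotient.mk M s) (by rwa [Ne, Ideal.Quotient.eq_zero_iff_mem])
    obtain ⟨w, rfl⟩ := Ideal.Quotient.mk_surjective w
    -- The next digit is the residue of `z / s`, where `w` inverts `s` modulo `M`.
    obtain ⟨b, hb⟩ := hres (z * w)
    have hzb : z - b * s ∈ M := by
      rw [← Ideal.Quotient.eq_zero_iff_mem] at hb ⊢
      simp only [map_sub, map_mul] at hb ⊢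
      linear_combination (Ideal.Quotient.mk M s) * hb - (Ideal.Quotient.mk M z) * hw
    obtain ⟨s', hs', q, hq⟩ := hlocal _ hzb
    refine ⟨s' * s, fun h => (hM.isPrime.mem_or_mem h).elim hs' hs, a + p ^ N * b, q, ?_⟩
    push_cast
    linear_combination s' * hz + (p : R) ^ N * hq

/-- Divisibility is local: near a maximal ideal of residue characteristic `p`, `x` agrees with an
integer modulo the `p`-part of `n!`, and for integers the claim is classical. -/
theorem factorial_dvd_ascPochhammer_eval {R : Type*} [CommRing R]
    (hfrob : ∀ p : ℕ, p.Prime → ∀ x : R, (p : R) ∣ x ^ p - x) (x : R) (n : ℕ) :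
    (n.factorial : R) ∣ (ascPochhammer R n).eval x := by
  set J : Ideal R := Submodule.colon (Ideal.span {(n.factorial : R)})
    {(ascPochhammer R n).eval x} with hJ
  have memJ : ∀ r, r ∈ J ↔ (n.factorial : R) ∣ r * (ascPochhammer R n).eval x := by
    intro r
    rw [hJ, Submodule.mem_colon_singleton, smul_eq_mul, Ideal.mem_span_singleton]
  by_contra hnot
  have hJtop : J ≠ ⊤ := by
    rw [Ideal.ne_top_iff_one, memJ, one_mul]
    exact hnot
  obtain ⟨M, hM, hJM⟩ := Ideal.exists_le_maximal J hJtop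
  have hnM : (n.factorial : R) ∈ M := hJM ((memJ _).2 (dvd_mul_right _ _))
  obtain ⟨p, hp, hpM⟩ : ∃ p : ℕ, p.Prime ∧ (p : R) ∈ M := by
    have hprime : ∀ k : ℕ, k ≠ 0 → (k : R) ∈ M → ∃ p : ℕ, p.Prime ∧ (p : R) ∈ M := by
      intro k
      induction k using Nat.recOnMul with
      | zero => intro h; exact absurd rfl h
      | one => intro _ h; exact absurd ((Ideal.eq_top_iff_one _).2 (by simpa using h)) hM.ne_top
      | prime p hp => exact fun _ h => ⟨p, hp, h⟩
      | mul a b ha hb =>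
        intro h hab
        rw [Nat.cast_mul] at hab
        exact (hM.isPrime.mem_or_mem hab).elim (ha (left_ne_zero_of_mul h))
          (hb (right_ne_zero_of_mul h))
    exact hprime _ (Nat.factorial_ne_zero n) hnM
  obtain ⟨N, v, hv, hNv⟩ := Nat.exists_eq_pow_mul_and_not_dvd (Nat.factorial_ne_zero n) p hp.ne_one
  have hvM : (v : R) ∉ M := by
    intro h
    have hcop : IsCoprime (v : ℤ) (p : ℤ) :=
      Nat.isCoprime_iff_coprime.2 ((hp.coprime_iff_not_dvd.2 hv).symm)
    obtain ⟨a, b, hab⟩ := hcop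
    have h1 : (a : R) * v + b * p = 1 := by exact_mod_cast congrArg (Int.cast : ℤ → R) hab
    exact hM.ne_top ((Ideal.eq_top_iff_one _).2
      (h1 ▸ M.add_mem (M.mul_mem_left _ h) (M.mul_mem_left _ hpM)))
  obtain ⟨s, hs, a, hsa⟩ := exists_notMem_mul_sub_intCast hp (hfrob p hp) M hpM x N
  have hmem : (v : R) * s ∈ J := by
    rw [memJ]
    have h1 : (n.factorial : R) ∣ (ascPochhammer R n).eval (a : R) := by
      have h2 : (n.factorial : ℤ) ∣ (ascPochhammer ℤ n).eval a := by
        rw [← Polynomial.ascPochhammer_smeval_eq_eval,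
          ← Ring.factorial_nsmul_multichoose_eq_ascPochhammer, nsmul_eq_mul]
        exact dvd_mul_right _ _
      have h3 := map_dvd (Int.castRingHom R) h2
      rw [← ascPochhammer_map (Int.castRingHom R), Polynomial.eval_intCast_map]
      simpa using h3
    have h4 : (n.factorial : R) ∣ v * (s * (x - a)) := by
      rw [hNv]
      push_cast
      rw [mul_comm]
      exact mul_dvd_mul_left _ hsa
    have h5 := Polynomial.sub_dvd_eval_sub x (a : R) (ascPochhammer R n)
    have h6 : (n.factorial : R) ∣
        v * s * ((ascPochhammer R n).eval x - (ascPochhammer R n).eval (a : R)) := by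
      refine h4.trans ?_
      rw [mul_assoc]
      exact mul_dvd_mul_left _ (mul_dvd_mul_left _ h5)
    have h7 := dvd_add h6 (h1.mul_left (v * s))
    rwa [← mul_add, sub_add_cancel] at h7
  exact (hM.isPrime.mem_or_mem (hJM hmem)).elim hvM hs

/-- `BinomialRing` is phrased with rising factorials; replacing `x` by `-x` turns these into the
usual binomial coefficients up to sign. -/
theorem nonempty_binomialRing_of_frobenius {R : Type*} [CommRing R]
    (htf : ∀ p : ℕ, p.Prime → ∀ x : R, (p : R) * x = 0 → x = 0)
    (hfrob : ∀ p : ℕ, p.Prime → ∀ x : R, (p : R) ∣ x ^ p - x) : Nonempty (BinomialRing R) := by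
  have htf' : ∀ n : ℕ, n ≠ 0 → ∀ x : R, (n : R) * x = 0 → x = 0 := by
    intro n
    induction n using Nat.recOnMul with
    | zero => intro h; exact absurd rfl h
    | one => intro _ x hx; simpa using hx
    | prime p hp => intro _; exact htf p hp
    | mul a b ha hb =>
      intro h x hx
      refine hb (right_ne_zero_of_mul h) x (ha (left_ne_zero_of_mul h) _ ?_)
      rw [← mul_assoc, ← Nat.cast_mul, hx]
  have : IsAddTorsionFree R := by
    refine ⟨fun n hn x y hxy => ?_⟩
    have : (n : R) * (x - y) = 0 := by
      simpa [nsmul_eq_mul, mul_sub, sub_eq_zero] using hxy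
    exact sub_eq_zero.1 (htf' n hn _ this)
  choose q hq using fun (x : R) (n : ℕ) => factorial_dvd_ascPochhammer_eval hfrob x n
  refine ⟨⟨q, fun x n => ?_⟩⟩
  rw [nsmul_eq_mul, ← hq, Polynomial.ascPochhammer_smeval_eq_eval]

theorem nonempty_binomialRing_away {R : Type*} [CommRing R] (m : ℕ)
    (htf : ∀ p : ℕ, p.Prime → ¬ p ∣ m → ∀ x : R, (p : R) * x = 0 → x = 0)
    (hfrob : ∀ p : ℕ, p.Prime → ¬ p ∣ m → ∀ x : R, (p : R) ∣ x ^ p - x) :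
    Nonempty (BinomialRing (Localization.Away (m : R))) := by
  have hunit : IsUnit (m : Localization.Away (m : R)) := by
    simpa using IsLocalization.Away.algebraMap_isUnit (S := Localization.Away (m : R)) (m : R)
  have hpm : ∀ p : ℕ, p ∣ m → IsUnit (p : Localization.Away (m : R)) := fun p h =>
    isUnit_of_dvd_unit (Nat.cast_dvd_cast h) hunit
  refine nonempty_binomialRing_of_frobenius (fun p hp x hx => ?_) (fun p hp x => ?_)
  · by_cases h : p ∣ m
    · exact ((hpm p h).mul_right_eq_zero).1 hx
    · obtain ⟨k, a, ha⟩ := IsLocalization.Away.surj (m : R) x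
      have h1 : algebraMap R (Localization.Away (m : R)) ((p : R) * a) = 0 := by
        rw [map_mul, ← ha, map_natCast, ← mul_assoc, hx, zero_mul]
      obtain ⟨⟨_, j, rfl⟩, hj⟩ := (IsLocalization.map_eq_zero_iff (Submonoid.powers (m : R))
        (Localization.Away (m : R)) _).1 h1
      have h2 := htf p hp h ((m : R) ^ j * a) (by rw [← hj]; ring)
      have h3 := (IsLocalization.map_eq_zero_iff (Submonoid.powers (m : R))
        (Localization.Away (m : R)) a).2 ⟨⟨_, j, rfl⟩, h2⟩
      rw [h3, map_natCast] at ha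
      exact ((hunit.pow k).mul_left_eq_zero).1 ha
  · by_cases h : p ∣ m
    · exact (hpm p h).dvd
    · obtain ⟨k, a, ha⟩ := IsLocalization.Away.surj (m : R) x
      rw [map_natCast] at ha
      have h1 : (p : Localization.Away (m : R)) ∣
          algebraMap R (Localization.Away (m : R)) a ^ p - algebraMap R _ a := by
        simpa using map_dvd (algebraMap R (Localization.Away (m : R))) (hfrob p hp h a)
      -- The congruence for the denominator `m ^ k` itself, combined with the one for `a = x * m ^
      -- k`, shows that `p` divides `m ^ k * (x ^ p - x)`.
      have h2 : (p : Localization.Away (m : R)) ∣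
          ((m : Localization.Away (m : R)) ^ k) ^ p - (m : Localization.Away (m : R)) ^ k := by
        simpa using map_dvd (algebraMap R (Localization.Away (m : R))) (hfrob p hp h ((m : R) ^ k))
      rw [← (hunit.pow k).dvd_mul_left (a := (p : Localization.Away (m : R)))]
      have h3 := dvd_sub h1 (h2.mul_right (x ^ p))
      rw [← ha] at h3
      convert h3 using 1
      ring

/-- The condition `φ s - s ^ p ∈ p I` passes from generators to all of `I`, because the cross terms
of `(x + y) ^ p` are `p` times an element of `I`. It may then be applied to `p * x ∈ I` and divided
by `p`. -/
theorem dvd_sub_and_torsionFree_of_frobenius_lift {P : Type*} [CommRing P] {p : ℕ}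
    (hp : p.Prime) (htf : ∀ x y : P, (p : P) * x = p * y → x = y) (S : Set P) (φ : P →+* P)
    (hφ : ∀ x, (p : P) ∣ φ x - x ^ p) (hφI : ∀ x, φ x - x ∈ Ideal.span S)
    (hS : ∀ s ∈ S, ∃ d ∈ Ideal.span S, φ s - s ^ p = p * d) :
    (∀ x : P ⧸ Ideal.span S, (p : P ⧸ Ideal.span S) ∣ x ^ p - x) ∧
    (∀ x : P ⧸ Ideal.span S, (p : P ⧸ Ideal.span S) * x = 0 → x = 0) := by
  have key : ∀ s ∈ Ideal.span S, ∃ d ∈ Ideal.span S, φ s - s ^ p = p * d := by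
    intro s hs
    induction hs using Submodule.span_induction with
    | mem s hs => exact hS s hs
    | zero => exact ⟨0, zero_mem _, by simp [hp.ne_zero]⟩
    | add x y hx hy ihx ihy =>
      obtain ⟨d, hd, hd'⟩ := ihx
      obtain ⟨e, he, he'⟩ := ihy
      obtain ⟨r, hr⟩ := exists_add_pow_prime_eq hp x y
      refine ⟨d + e - x * y * r, sub_mem (add_mem hd he)
        (Ideal.mul_mem_right _ _ (Ideal.mul_mem_right _ _ hx)), ?_⟩
      rw [map_add, hr]
      linear_combination hd' + he'
    | smul a x hx ihx =>
      obtain ⟨d, hd, hd'⟩ := ihx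
      obtain ⟨e, he⟩ := hφ a
      refine ⟨φ a * d + e * x ^ p, add_mem (Ideal.mul_mem_left _ _ hd)
        (Ideal.mul_mem_left _ _ (Ideal.pow_mem_of_mem _ hx _ hp.pos)), ?_⟩
      rw [smul_eq_mul, map_mul, mul_pow]
      linear_combination φ a * hd' + x ^ p * he
  constructor
  · intro x
    obtain ⟨x, rfl⟩ := Ideal.Quotient.mk_surjective x
    obtain ⟨e, he⟩ := hφ x
    refine ⟨Ideal.Quotient.mk _ (-e), ?_⟩
    rw [← map_natCast (Ideal.Quotient.mk (Ideal.span S)), ← map_pow, ← map_sub, ← map_mul,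
      Ideal.Quotient.mk_eq_mk_iff_sub_mem]
    convert hφI x using 1
    linear_combination -he
  · intro x
    obtain ⟨x, rfl⟩ := Ideal.Quotient.mk_surjective x
    rw [← map_natCast (Ideal.Quotient.mk (Ideal.span S)), ← map_mul,
      Ideal.Quotient.eq_zero_iff_mem, Ideal.Quotient.eq_zero_iff_mem]
    intro hx
    obtain ⟨d, hd, hd'⟩ := key _ hx
    -- Since `p ≥ 2`, the quotient `(p x) ^ p / p` is still a multiple of `p x`, hence lies in the
    -- ideal.
    obtain ⟨q, rfl⟩ : ∃ q, p = q + 2 := ⟨p - 2, by have := hp.two_le; omega⟩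
    have h1 : φ x - ((q + 2 : ℕ) : P) ^ q * x ^ (q + 1) * (((q + 2 : ℕ) : P) * x) = d := by
      apply htf
      rw [← hd', map_mul, map_natCast]
      ring
    have h2 : φ x ∈ Ideal.span S := by
      rw [← sub_add_cancel (φ x) (((q + 2 : ℕ) : P) ^ q * x ^ (q + 1) * (((q + 2 : ℕ) : P) * x)),
        h1]
      exact add_mem hd (Ideal.mul_mem_left _ _ hx)
    have h3 := sub_mem h2 (hφI x)
    rwa [sub_sub_cancel] at h3

/-- For a relation `a = b`, the cross terms of `((a - b) + b) ^ p` are multiples of `p (a - b)`;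
only the correction terms `α` and `β` have to be compared modulo `I`. -/
theorem exists_mem_frobenius_lift_sub {P : Type*} [CommRing P] {p : ℕ} (hp : p.Prime)
    {I : Ideal P} (φ : P →+* P) {a b α β : P} (hab : a - b ∈ I) (ha : φ a = a ^ p + p * α)
    (hb : φ b = b ^ p + p * β) (hαβ : α - β ∈ I) :
    ∃ d ∈ I, φ (a - b) - (a - b) ^ p = p * d := by
  obtain ⟨r, hr⟩ := exists_add_pow_prime_eq hp (a - b) b
  rw [sub_add_cancel] at hr
  refine ⟨α - β + (a - b) * b * r, add_mem hαβ
    (Ideal.mul_mem_right _ _ (Ideal.mul_mem_right _ _ hab)), ?_⟩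
  rw [map_sub, ha, hb]
  linear_combination hr

end Algebra

/-! ### Smooth sets, invariant subsets and finite products. -/

section SmoothSets

variable {G : Type u} [Group G] (𝓔 : Set (Subgroup G))

/-- A type with an action of `G` is an `𝓔`-smooth `G`-set. -/
class IsSmoothSet (Y : Type u) [MulAction G Y] : Prop where
  finitary : Finite (MulAction.orbitRel.Quotient G Y)
  stabilizer_mem : ∀ y : Y, MulAction.stabilizer G y ∈ 𝓔

/-- The `𝓔`-smooth `G`-sets are closed under finite products. -/
class HasSmoothProducts : Prop where
  top_mem : ⊤ ∈ 𝓔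
  prod : ∀ (Y Z : Type u) [MulAction G Y] [MulAction G Z] [IsSmoothSet 𝓔 Y] [IsSmoothSet 𝓔 Z],
    IsSmoothSet 𝓔 (Y × Z)

instance SmoothGSet.isSmoothSet (X : SmoothGSet G 𝓔) : IsSmoothSet 𝓔 X := ⟨X.finitary, X.smooth⟩

variable {𝓔} in
theorem IsSmoothSet.of_injective {Y Z : Type u} [MulAction G Y] [MulAction G Z] [IsSmoothSet 𝓔 Z]
    (i : Y →[G] Z) (hi : Function.Injective i) : IsSmoothSet 𝓔 Y where
  finitary := by
    have := IsSmoothSet.finitary (𝓔 := 𝓔) (Y := Z)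
    refine Finite.of_injective (β := MulAction.orbitRel.Quotient G Z)
      (Quotient.map i fun a b h => ?_) ?_
    · obtain ⟨g, rfl⟩ := h
      exact ⟨g, (map_smul i g b).symm⟩
    · rintro ⟨a⟩ ⟨b⟩ h
      obtain ⟨g, hg⟩ := Quotient.exact h
      exact Quotient.sound ⟨g, hi (by simpa using hg)⟩
  stabilizer_mem y := by
    convert IsSmoothSet.stabilizer_mem (𝓔 := 𝓔) (i y) using 1
    ext g
    simp only [MulAction.mem_stabilizer_iff, ← map_smul]
    exact hi.eq_iff.symm

instance {Y : Type u} [MulAction G Y] [IsSmoothSet 𝓔 Y] (D : SubMulAction G Y) :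
    IsSmoothSet 𝓔 D :=
  IsSmoothSet.of_injective D.subtype Subtype.val_injective

instance [HasSmoothProducts 𝓔] {Y Z : Type u} [MulAction G Y] [MulAction G Z] [IsSmoothSet 𝓔 Y]
    [IsSmoothSet 𝓔 Z] : IsSmoothSet 𝓔 (Y × Z) :=
  HasSmoothProducts.prod Y Z

theorem isSmoothSet_of_unique [HasSmoothProducts 𝓔] (Y : Type u) [MulAction G Y] [Unique Y] :
    IsSmoothSet 𝓔 Y where
  finitary := Quotient.finite _
  stabilizer_mem y := by
    convert HasSmoothProducts.top_mem (𝓔 := 𝓔)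
    ext g
    simp [Subsingleton.elim (g • y) y]

instance isSmoothSet_pi [HasSmoothProducts 𝓔] {ι : Type} [Finite ι] (Y : ι → Type u)
    [∀ i, MulAction G (Y i)] [∀ i, IsSmoothSet 𝓔 (Y i)] : IsSmoothSet 𝓔 (∀ i, Y i) := by
  revert Y
  induction ι using Finite.induction_empty_option with
  | of_equiv e ih =>
    intro Y _ _
    have := ih (fun i => Y (e i))
    refine IsSmoothSet.of_injective (Z := ∀ i, Y (e i)) ⟨fun t i => t (e i), fun _ _ => rfl⟩ ?_
    intro s t h
    ext i
    obtain ⟨i, rfl⟩ := e.surjective i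
    exact congrFun h i
  | h_empty =>
    intro Y _ _
    exact isSmoothSet_of_unique 𝓔 _
  | h_option ih =>
    intro Y _ _
    have := ih (fun i => Y (some i))
    refine IsSmoothSet.of_injective (Z := Y none × ∀ i, Y (some i))
      ⟨fun t => (t none, fun i => t (some i)), fun _ _ => rfl⟩ ?_
    intro s t h
    ext i
    rcases i with _ | i
    · exact congrArg Prod.fst h
    · exact congrFun (congrArg Prod.snd h) i

/-- A smooth set as a bundled object. -/
abbrev SmoothGSet.of (Y : Type u) [MulAction G Y] [h : IsSmoothSet 𝓔 Y] : SmoothGSet G 𝓔 where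
  carrier := Y
  finitary := h.finitary
  smooth := h.stabilizer_mem

end SmoothSets

/-! ### Invariant subsets: preimages and orbits. -/

section SubMulActions

variable {G : Type u} [Group G] {Y X : Type u} [MulAction G Y] [MulAction G X]

/-- The preimage of an invariant subset under an equivariant map. -/
def preimageSub (h : Y →[G] X) (D : SubMulAction G X) : SubMulAction G Y where
  carrier := {y | h y ∈ D}
  smul_mem' g y hy := by
    simp only [Set.mem_ofPred_eq, map_smul] at hy ⊢
    exact D.smul_mem g hy

@[simp]
theorem mem_preimageSub {h : Y →[G] X} {D : SubMulAction G X} {y : Y} :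
    y ∈ preimageSub h D ↔ h y ∈ D := Iff.rfl

/-- The restriction of an equivariant map to the preimage of an invariant subset. -/
def restrictSub (h : Y →[G] X) (D : SubMulAction G X) : preimageSub h D →[G] D where
  toFun y := ⟨h y, y.2⟩
  map_smul' g y := Subtype.ext (map_smul h g (y : Y))

/-- An orbit as an invariant subset. -/
def orbitSub (o : MulAction.orbitRel.Quotient G Y) : SubMulAction G Y where
  carrier := {y | (Quotient.mk'' y : MulAction.orbitRel.Quotient G Y) = o}
  smul_mem' g y hy := by
    rw [Set.mem_ofPred_eq] at hy ⊢
    rw [← hy]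
    exact Quotient.sound ⟨g, rfl⟩

instance (o : MulAction.orbitRel.Quotient G Y) : Nonempty (orbitSub o) := by
  obtain ⟨y, rfl⟩ := Quotient.exists_rep o
  exact ⟨⟨y, rfl⟩⟩

instance (o : MulAction.orbitRel.Quotient G Y) : MulAction.IsPretransitive G (orbitSub o) where
  exists_smul_eq := by
    rintro ⟨x, hx⟩ ⟨y, hy⟩
    obtain ⟨g, hg⟩ := Quotient.exact (hy.trans hx.symm)
    exact ⟨g, Subtype.ext hg⟩

end SubMulActions

/-! ### Calculus of classes: additivity, composition, fiber products. -/

section ThetaClass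

variable {G : Type u} [Group G] (𝓔 : Set (Subgroup G))

/-- The class in `Θ(G, 𝓔)` of a map to a transitive smooth set. -/
noncomputable def thetaClass {Y X : Type u} [MulAction G Y] [MulAction G X] [IsSmoothSet 𝓔 Y]
    [IsSmoothSet 𝓔 X] [hn : Nonempty X] [ht : MulAction.IsPretransitive G X] (f : Y →[G] X) :
    Theta G 𝓔 :=
  Ideal.Quotient.mk _ (mapSymbol (Y := .of 𝓔 Y) (X := .of 𝓔 X) ⟨hn, ht⟩ f)

variable {Z Y X : Type u} [MulAction G Z] [MulAction G Y] [MulAction G X] [IsSmoothSet 𝓔 Z]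
  [IsSmoothSet 𝓔 Y] [IsSmoothSet 𝓔 X] [Nonempty X] [MulAction.IsPretransitive G X]

theorem thetaClass_of_bijective (f : Y →[G] X) (hf : Function.Bijective f) :
    thetaClass 𝓔 f = 1 := by
  rw [← map_one (Ideal.Quotient.mk _)]
  exact (Ideal.Quotient.mk_eq_mk_iff_sub_mem _ _).2 (Ideal.subset_span (.iso _ _ hf))

theorem thetaClass_add {Y₁ Y₂ : Type u} [MulAction G Y₁] [MulAction G Y₂] [IsSmoothSet 𝓔 Y₁]
    [IsSmoothSet 𝓔 Y₂] (f : Y →[G] X) (i₁ : Y₁ →[G] Y) (i₂ : Y₂ →[G] Y)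
    (h : Function.Bijective (Sum.elim i₁ i₂)) :
    thetaClass 𝓔 f = thetaClass 𝓔 (f.comp i₁) + thetaClass 𝓔 (f.comp i₂) := by
  unfold thetaClass
  rw [← map_add]
  exact (Ideal.Quotient.mk_eq_mk_iff_sub_mem _ _).2 (Ideal.subset_span
    (.add (Y := .of 𝓔 Y) (X := .of 𝓔 X) (Y₁ := .of 𝓔 Y₁) (Y₂ := .of 𝓔 Y₂) _ f i₁ i₂ h))

theorem thetaClass_comp_of_transitive [Nonempty Z] [MulAction.IsPretransitive G Z] [Nonempty Y]
    [MulAction.IsPretransitive G Y] (f : Y →[G] X) (g : Z →[G] Y) :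
    thetaClass 𝓔 (f.comp g) = thetaClass 𝓔 f * thetaClass 𝓔 g := by
  unfold thetaClass
  rw [← map_mul]
  exact (Ideal.Quotient.mk_eq_mk_iff_sub_mem _ _).2 (Ideal.subset_span
    (.comp (Z := .of 𝓔 Z) (Y := .of 𝓔 Y) (X := .of 𝓔 X) ⟨‹_›, ‹_›⟩ _ _ f g))

theorem thetaClass_baseChange {Y' X' : Type u} [MulAction G Y'] [MulAction G X']
    [IsSmoothSet 𝓔 Y'] [IsSmoothSet 𝓔 X'] [Nonempty X'] [MulAction.IsPretransitive G X']
    (f : Y →[G] X) (g : X' →[G] X) (f' : Y' →[G] X') (g' : Y' →[G] Y)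
    (comm : ∀ y' : Y', f (g' y') = g (f' y'))
    (cartesian : ∀ (y : Y) (x' : X'), f y = g x' → ∃! y' : Y', g' y' = y ∧ f' y' = x') :
    thetaClass 𝓔 f = thetaClass 𝓔 f' :=
  (Ideal.Quotient.mk_eq_mk_iff_sub_mem _ _).2 (Ideal.subset_span
    (.baseChange (Y := .of 𝓔 Y) (X := .of 𝓔 X) (Y' := .of 𝓔 Y') (X' := .of 𝓔 X')
      _ _ f g f' g' comm cartesian))

theorem thetaClass_congr {Y' : Type u} [MulAction G Y'] [IsSmoothSet 𝓔 Y'] (f : Y →[G] X)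
    (f' : Y' →[G] X) (e : Y' →[G] Y) (he : Function.Bijective e) (h : ∀ y, f (e y) = f' y) :
    thetaClass 𝓔 f = thetaClass 𝓔 f' := by
  refine thetaClass_baseChange 𝓔 f (MulActionHom.id G) f' e h fun y x hyx => ?_
  obtain ⟨y', rfl⟩ := he.2 y
  exact ⟨y', ⟨rfl, (h y').symm.trans hyx⟩, fun z hz => he.1 hz.1⟩

/-- The class of the restriction of a map to an invariant subset of the source. -/
noncomputable def subClass (f : Y →[G] X) (D : SubMulAction G Y) : Theta G 𝓔 :=
  thetaClass 𝓔 (f.comp D.subtype)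

theorem subClass_congr {Y' : Type u} [MulAction G Y'] [IsSmoothSet 𝓔 Y'] (f : Y →[G] X)
    (f' : Y' →[G] X) (D : SubMulAction G Y) (D' : SubMulAction G Y') (e : Y' →[G] Y)
    (he : Set.BijOn e D' D) (h : ∀ y ∈ D', f (e y) = f' y) :
    subClass 𝓔 f D = subClass 𝓔 f' D' := by
  refine thetaClass_congr 𝓔 _ _
    ⟨fun y => ⟨e y, he.mapsTo y.2⟩, fun g y => Subtype.ext (map_smul e g (y : Y'))⟩
    ⟨fun a b hab => ?_, fun b => ?_⟩ fun y => h y y.2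
  · exact Subtype.ext (he.injOn a.2 b.2 (congrArg Subtype.val hab))
  · obtain ⟨a, ha, hab⟩ := he.surjOn b.2
    exact ⟨⟨a, ha⟩, Subtype.ext hab⟩

theorem subClass_eq_thetaClass {Y' : Type u} [MulAction G Y'] [IsSmoothSet 𝓔 Y'] (f : Y →[G] X)
    (f' : Y' →[G] X) (D : SubMulAction G Y) (e : Y' →[G] Y) (he : Function.Injective e)
    (hD : ∀ y, y ∈ D ↔ y ∈ Set.range e) (h : ∀ y, f (e y) = f' y) :
    subClass 𝓔 f D = thetaClass 𝓔 f' := by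
  refine thetaClass_congr 𝓔 _ _
    ⟨fun y => ⟨e y, (hD _).2 ⟨y, rfl⟩⟩, fun g y => Subtype.ext (map_smul e g (y : Y'))⟩
    ⟨fun a b hab => he (congrArg Subtype.val hab), fun b => ?_⟩ h
  obtain ⟨a, ha⟩ := (hD b).1 b.2
  exact ⟨a, Subtype.ext ha⟩

theorem subClass_union (f : Y →[G] X) (D D₁ D₂ : SubMulAction G Y)
    (hD : ∀ y, y ∈ D ↔ y ∈ D₁ ∨ y ∈ D₂) (hdisj : ∀ y ∈ D₁, y ∉ D₂) :
    subClass 𝓔 f D = subClass 𝓔 f D₁ + subClass 𝓔 f D₂ := by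
  refine thetaClass_add 𝓔 (f.comp D.subtype)
    (⟨fun y => ⟨y, (hD _).2 (.inl y.2)⟩, fun _ _ => rfl⟩ : D₁ →[G] D)
    (⟨fun y => ⟨y, (hD _).2 (.inr y.2)⟩, fun _ _ => rfl⟩ : D₂ →[G] D) ⟨?_, ?_⟩
  · rintro (⟨a, ha⟩ | ⟨a, ha⟩) (⟨b, hb⟩ | ⟨b, hb⟩) hab <;>
      obtain rfl : a = b := congrArg Subtype.val hab
    · rfl
    · exact absurd hb (hdisj _ ha)
    · exact absurd ha (hdisj _ hb)
    · rfl
  · rintro ⟨a, ha⟩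
    rcases (hD a).1 ha with h | h
    · exact ⟨.inl ⟨a, h⟩, rfl⟩
    · exact ⟨.inr ⟨a, h⟩, rfl⟩

theorem subClass_of_empty (f : Y →[G] X) (D : SubMulAction G Y) (hD : ∀ y, y ∉ D) :
    subClass 𝓔 f D = 0 := by
  -- An empty set is the disjoint union of two copies of itself, so its class equals twice itself.
  have := subClass_union 𝓔 f D D D (by simp) (fun y hy => absurd hy (hD y))
  simpa using this

theorem subClass_sum {ι : Type*} (f : Y →[G] X) (s : Finset ι) (D : SubMulAction G Y)
    (E : ι → SubMulAction G Y) (hD : ∀ y, y ∈ D ↔ ∃ i ∈ s, y ∈ E i)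
    (hdisj : ∀ i ∈ s, ∀ j ∈ s, ∀ y ∈ E i, y ∈ E j → i = j) :
    subClass 𝓔 f D = ∑ i ∈ s, subClass 𝓔 f (E i) := by
  classical
  induction s using Finset.induction_on generalizing D with
  | empty => exact subClass_of_empty 𝓔 f D (by simpa using hD)
  | insert a s ha ih =>
    let D' : SubMulAction G Y :=
      ⟨{y | ∃ i ∈ s, y ∈ E i}, fun g y ⟨i, hi, hy⟩ => ⟨i, hi, (E i).smul_mem g hy⟩⟩
    rw [Finset.sum_insert ha, ← ih D' (fun _ => Iff.rfl)
      fun i hi j hj => hdisj i (Finset.mem_insert_of_mem hi) j (Finset.mem_insert_of_mem hj)]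
    refine subClass_union 𝓔 f D (E a) D' (fun y => ?_) ?_
    · rw [hD, Finset.exists_mem_insert]
      rfl
    · rintro y hy ⟨i, hi, hyi⟩
      have := hdisj a (Finset.mem_insert_self _ _) i (Finset.mem_insert_of_mem hi) y hy hyi
      exact ha (this ▸ hi)

theorem subClass_top (f : Y →[G] X) (D : SubMulAction G Y) (hD : ∀ y, y ∈ D) :
    subClass 𝓔 f D = thetaClass 𝓔 f :=
  subClass_eq_thetaClass 𝓔 f f D (MulActionHom.id G) Function.injective_id
    (fun y => ⟨fun _ => ⟨y, rfl⟩, fun _ => hD y⟩) fun _ => rfl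

theorem thetaClass_eq_sum_preimage {W : Type u} [MulAction G W] [IsSmoothSet 𝓔 W]
    [Fintype (MulAction.orbitRel.Quotient G W)] (f : Y →[G] X) (h : Y →[G] W) :
    thetaClass 𝓔 f = ∑ o : MulAction.orbitRel.Quotient G W,
      subClass 𝓔 f (preimageSub h (orbitSub o)) := by
  rw [← subClass_top 𝓔 f ⊤ fun _ => trivial]
  refine subClass_sum 𝓔 f _ _ _ (fun y => ?_) ?_
  · exact ⟨fun _ => ⟨_, Finset.mem_univ _, rfl⟩, fun _ => trivial⟩
  · rintro i - j - y hi hj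
    exact hi.symm.trans hj

/-- The defining relation needs a transitive source; splitting `Z` into orbits removes this
restriction. -/
theorem thetaClass_comp [Nonempty Y] [MulAction.IsPretransitive G Y] (f : Y →[G] X)
    (g : Z →[G] Y) : thetaClass 𝓔 (f.comp g) = thetaClass 𝓔 f * thetaClass 𝓔 g := by
  have := IsSmoothSet.finitary (𝓔 := 𝓔) (Y := Z)
  have := Fintype.ofFinite (MulAction.orbitRel.Quotient G Z)
  rw [thetaClass_eq_sum_preimage 𝓔 (f.comp g) (MulActionHom.id G),
    thetaClass_eq_sum_preimage 𝓔 g (MulActionHom.id G), Finset.mul_sum]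
  refine Finset.sum_congr rfl fun o _ => ?_
  exact thetaClass_comp_of_transitive 𝓔 f (g.comp (orbitSub o).subtype)

/-- If all restrictions of `g` to the orbits of its target have the same class `c`, then
composition with `g` multiplies classes by `c`. -/
theorem thetaClass_comp_of_const (f : Y →[G] X) (g : Z →[G] Y) (c : Theta G 𝓔)
    (hc : ∀ o, thetaClass 𝓔 (restrictSub g (orbitSub o)) = c) :
    thetaClass 𝓔 (f.comp g) = thetaClass 𝓔 f * c := by
  have := IsSmoothSet.finitary (𝓔 := 𝓔) (Y := Y)
  have := Fintype.ofFinite (MulAction.orbitRel.Quotient G Y)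
  rw [thetaClass_eq_sum_preimage 𝓔 (f.comp g) g,
    thetaClass_eq_sum_preimage 𝓔 f (MulActionHom.id G), Finset.sum_mul]
  refine Finset.sum_congr rfl fun o _ => ?_
  have := thetaClass_comp 𝓔 (f.comp (orbitSub o).subtype) (restrictSub g (orbitSub o))
  rw [hc o] at this
  exact this

/-- `W` is the fiber product over `X` of the family of maps `f i : Y i → X`. -/
structure IsFiberProduct {ι : Type} {Y : ι → Type u} [∀ i, MulAction G (Y i)]
    (f : ∀ i, Y i →[G] X) {W : Type u} [MulAction G W] (w : W →[G] X) (π : ∀ i, W →[G] Y i) :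
    Prop where
  comm : ∀ i a, f i (π i a) = w a
  existsUnique : ∀ (x : X) (y : ∀ i, Y i), (∀ i, f i (y i) = x) →
    ∃! a, w a = x ∧ ∀ i, π i a = y i

/-- The class of a fiber product is the product of the classes. -/
theorem thetaClass_fiberProduct [HasSmoothProducts 𝓔] {ι : Type} [Finite ι] :
    ∀ [Fintype ι] (Y : ι → Type u) [∀ i, MulAction G (Y i)] [∀ i, IsSmoothSet 𝓔 (Y i)]
      (f : ∀ i, Y i →[G] X) (W : Type u) [MulAction G W] [IsSmoothSet 𝓔 W] (w : W →[G] X)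
      (π : ∀ i, W →[G] Y i),
      IsFiberProduct f w π → thetaClass 𝓔 w = ∏ i, thetaClass 𝓔 (f i) := by
  induction ι using Finite.induction_empty_option with
  | of_equiv e ih =>
    intro _ Y _ _ f W _ _ w π ⟨comm, cartesian⟩
    let := Fintype.ofEquiv _ e.symm
    rw [ih (fun i => Y (e i)) (fun i => f (e i)) W w (fun i => π (e i)) ⟨fun i => comm (e i), ?_⟩]
    · exact Fintype.prod_equiv e _ _ fun _ => rfl
    · intro x y hy
      obtain ⟨y, rfl⟩ := (Equiv.piCongrLeft Y e).symm.surjective y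
      obtain ⟨a, ⟨ha, ha'⟩, hu⟩ := cartesian x y fun i => by
        obtain ⟨i, rfl⟩ := e.surjective i
        exact hy i
      refine ⟨a, ⟨ha, fun i => ha' (e i)⟩, fun b hb => hu b ⟨hb.1, fun i => ?_⟩⟩
      obtain ⟨i, rfl⟩ := e.surjective i
      exact hb.2 i
  | h_empty =>
    intro _ Y _ _ f W _ _ w π ⟨comm, cartesian⟩
    rw [Fintype.prod_empty]
    refine thetaClass_of_bijective 𝓔 w ⟨fun a b hab => ?_, fun x => ?_⟩
    · obtain ⟨c, -, hc⟩ := cartesian (w a) (fun i => i.elim) (fun i => i.elim)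
      rw [hc a ⟨rfl, fun i => i.elim⟩, hc b ⟨hab.symm, fun i => i.elim⟩]
    · obtain ⟨c, hc, -⟩ := cartesian x (fun i => i.elim) (fun i => i.elim)
      exact ⟨c, hc.1⟩
  | @h_option α _ ih =>
    intro hι Y _ _ f W _ _ w π ⟨comm, cartesian⟩
    let W' : SubMulAction G (X × ∀ i, Y (some i)) :=
      ⟨{t | ∀ i, f (some i) (t.2 i) = t.1}, fun g t ht i => by
        simp only [Set.mem_ofPred_eq] at ht
        simp [ht]⟩
    let w' : W' →[G] X := ⟨fun t => t.1.1, fun _ _ => rfl⟩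
    let q : W →[G] W' := ⟨fun a => ⟨(w a, fun i => π (some i) a), fun i => comm (some i) a⟩,
      fun g a => Subtype.ext (by ext <;> simp)⟩
    have h1 : thetaClass 𝓔 w' = ∏ i, thetaClass 𝓔 (f (some i)) := by
      refine ih (fun i => Y (some i)) (fun i => f (some i)) W' w'
        (fun i => ⟨fun t => t.1.2 i, fun _ _ => rfl⟩) ⟨fun i t => t.2 i, fun x y hy => ?_⟩
      refine ⟨⟨(x, y), hy⟩, ⟨rfl, fun _ => rfl⟩, fun b hb => Subtype.ext (Prod.ext hb.1 ?_)⟩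
      exact funext hb.2
    obtain rfl : hι = instFintypeOption := Subsingleton.elim _ _
    rw [Fintype.prod_option, ← h1, mul_comm]
    -- One factor is peeled off: over each orbit of the remaining fiber product `W'`, the projection
    -- `q` is a base change of `f none`, so its class there is constant.
    refine thetaClass_comp_of_const 𝓔 w' q _ fun o => ?_
    symm
    refine thetaClass_baseChange 𝓔 (f none) (w'.comp (orbitSub o).subtype) _
      ((π none).comp (SubMulAction.subtype _)) (fun a => comm none a) ?_
    rintro y ⟨t, ht⟩ hyt
    obtain ⟨a, ⟨ha, ha'⟩, hu⟩ := cartesian t.1.1 (fun i => i.rec y t.1.2) (by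
      rintro (_ | i)
      · exact hyt
      · exact t.2 i)
    have hq : q a = t := Subtype.ext (Prod.ext ha (funext fun i => ha' (some i)))
    refine ⟨⟨a, mem_preimageSub.2 (hq.symm ▸ ht)⟩, ⟨ha' none, Subtype.ext hq⟩, ?_⟩
    rintro ⟨b, hb⟩ ⟨hb1, hb2⟩
    refine Subtype.ext (hu b ?_)
    have hb3 : q b = t := congrArg Subtype.val hb2
    subst hb3
    refine ⟨rfl, ?_⟩
    rintro (_ | i)
    · exact hb1
    · rfl

end ThetaClass

/-! ### Cyclic tuples, rotation domains and the binomial expansion. -/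

section Tuples

variable {p : ℕ} {G : Type*} [Group G] {Y X : Type*} [MulAction G Y] [MulAction G X]

/-- All entries of a tuple are equal. -/
def IsConstTuple {A : Type*} (t : ZMod p → A) : Prop := ∀ i j, t i = t j

variable (G) in
/-- Rotation of cyclic tuples. -/
def rotate (c : ZMod p) : (ZMod p → Y) →[G] (ZMod p → Y) := ⟨fun t i => t (i + c), fun _ _ => rfl⟩

@[simp]
theorem rotate_apply (c : ZMod p) (t : ZMod p → Y) (i : ZMod p) :
    rotate G c t i = t (i + c) := rfl

@[simp]
theorem rotate_rotate (c d : ZMod p) (t : ZMod p → Y) :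
    rotate G c (rotate G d t) = rotate G (c + d) t := by
  ext i
  simp [add_assoc]

@[simp]
theorem rotate_zero (t : ZMod p → Y) : rotate G (0 : ZMod p) t = t := by
  ext i
  simp

theorem isConstTuple_rotate {A : Type*} (c : ZMod p) (t : ZMod p → A) :
    IsConstTuple (fun i => t (i + c)) ↔ IsConstTuple t :=
  ⟨fun h i j => by simpa using h (i - c) (j - c), fun h _ _ => h _ _⟩

variable (p) in
/-- The map to the base on `p`-tuples, given by the entry at `0`. -/
def powMap (f : Y →[G] X) : (ZMod p → Y) →[G] X :=
  ⟨fun t => f (t 0), fun g t => map_smul f g (t 0)⟩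

@[simp]
theorem powMap_apply (f : Y →[G] X) (t : ZMod p → Y) : powMap p f t = f (t 0) := rfl

/-- `D` is an invariant fundamental domain for the rotation of the nonconstant `p`-tuples in the
fibers of `f`. -/
structure IsRotationDomain (f : Y →[G] X) (D : SubMulAction G (ZMod p → Y)) : Prop where
  fiber : ∀ t ∈ D, IsConstTuple fun i => f (t i)
  nonconst : ∀ t ∈ D, ¬ IsConstTuple t
  existsUnique : ∀ t : ZMod p → Y, (IsConstTuple fun i => f (t i)) → ¬ IsConstTuple t →
    ∃! c : ZMod p, rotate G c t ∈ D

/-- Choose one tuple in each orbit of `G` together with rotations and keep its `G`-orbit. By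
`hfree`, distinct rotations of a nonconstant tuple lie in distinct `G`-orbits, which gives
uniqueness. -/
theorem exists_isRotationDomain (f : Y →[G] X)
    (hfree : ∀ (t : ZMod p → Y) (g : G) (c : ZMod p), (∀ i, g • t i = t (i + c)) → c ≠ 0 →
      IsConstTuple t) :
    ∃ D : SubMulAction G (ZMod p → Y), IsRotationDomain f D := by
  let r : Setoid (ZMod p → Y) :=
    { r := fun s t => ∃ (g : G) (c : ZMod p), g • rotate G c s = t
      iseqv :=
        { refl := fun s => ⟨1, 0, by simp⟩
          symm := by
            rintro s _ ⟨g, c, rfl⟩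
            exact ⟨g⁻¹, -c, by simp⟩
          trans := by
            rintro s _ _ ⟨g, c, rfl⟩ ⟨h, d, rfl⟩
            exact ⟨h * g, d + c, by simp [mul_smul]⟩ } }
  have hfib : ∀ (g : G) (t : ZMod p → Y), (IsConstTuple fun i => f ((g • t) i)) ↔
      IsConstTuple fun i => f (t i) := by
    intro g t
    simp only [IsConstTuple, Pi.smul_apply, map_smul, smul_left_cancel_iff]
  have hcon : ∀ (g : G) (t : ZMod p → Y), IsConstTuple (g • t) ↔ IsConstTuple t := by
    intro g t
    simp only [IsConstTuple, Pi.smul_apply, smul_left_cancel_iff]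
  let D : SubMulAction G (ZMod p → Y) :=
    { carrier := {t | (IsConstTuple fun i => f (t i)) ∧ ¬ IsConstTuple t ∧
        ∃ g : G, t = g • (Quotient.mk r t).out}
      smul_mem' := by
        rintro g t ⟨h1, h2, h, h3⟩
        refine ⟨(hfib g t).2 h1, mt (hcon g t).1 h2, g * h, ?_⟩
        have : Quotient.mk r (g • t) = Quotient.mk r t :=
          (Quotient.sound (s := r) ⟨g, 0, by simp⟩ : Quotient.mk r t = _).symm
        rw [this, mul_smul, ← h3] }
  refine ⟨D, fun t ht => ht.1, fun t ht => ht.2.1, fun t h1 h2 => ?_⟩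
  have hrot : ∀ c, Quotient.mk r (rotate G c t) = Quotient.mk r t := fun c =>
    (Quotient.sound (s := r) ⟨1, c, by simp⟩ : Quotient.mk r t = _).symm
  have hmem : ∀ c, rotate G c t ∈ D ↔ ∃ g : G, rotate G c t = g • (Quotient.mk r t).out := by
    intro c
    rw [← hrot c]
    exact ⟨fun h => h.2.2, fun h => ⟨(isConstTuple_rotate c fun i => f (t i)).2 h1,
      mt (isConstTuple_rotate c t).1 h2, h⟩⟩
  simp only [hmem]
  obtain ⟨g, c, hgc⟩ := Quotient.mk_out (s := r) t
  generalize (Quotient.mk r t).out = o at hgc ⊢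
  subst hgc
  refine ⟨-c, ⟨g, by simp⟩, ?_⟩
  rintro d ⟨k, hk⟩
  by_contra hdc
  refine h2 ((hcon g _).2 ((isConstTuple_rotate c o).2 (hfree o (g⁻¹ * k) (d + c) (fun i => ?_)
    fun h => hdc (eq_neg_of_add_eq_zero_left h))))
  rw [map_smul, rotate_rotate] at hk
  have := congrFun (congrArg (g⁻¹ • ·) hk) i
  simpa [mul_smul] using this.symm

theorem isConstTuple_of_eq_add [Fact p.Prime] {A : Type*} {t : ZMod p → A} {c : ZMod p}
    (hc : c ≠ 0) (h : ∀ i, t i = t (i + c)) : IsConstTuple t := by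
  have key : ∀ n : ℕ, ∀ i, t i = t (i + n * c) := by
    intro n
    induction n with
    | zero => simp
    | succ n ih =>
      intro i
      rw [ih i, h]
      congr 1
      push_cast
      ring
  intro i j
  rw [key ((j - i) / c).val i, ZMod.natCast_zmod_val, div_mul_cancel₀ _ hc, add_sub_cancel]

variable (p) in
theorem exists_boolean_rotation_representatives [Fact p.Prime] :
    ∃ T : Finset (ZMod p → Bool), (∀ s ∈ T, ¬ IsConstTuple s) ∧
      ∀ s : ZMod p → Bool, ¬ IsConstTuple s → ∃! c : ZMod p, (fun i => s (i + c)) ∈ T := by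
  classical
  -- With a trivial group action and a constant map, the fiber condition is vacuous and a rotation
  -- domain is just a set of representatives.
  let _ : MulAction Unit Bool :=
    { smul := fun _ b => b, one_smul := fun _ => rfl, mul_smul := fun _ _ _ => rfl }
  let f : MulActionHom (@id Unit) Bool Bool := ⟨fun _ => true, fun _ _ => rfl⟩
  obtain ⟨D, hD⟩ := exists_isRotationDomain (p := p) f
    fun t g c h hc => isConstTuple_of_eq_add hc h
  refine ⟨Finset.univ.filter (· ∈ D), fun s hs => hD.nonconst s (by simpa using hs),
    fun s hs => ?_⟩
  simp only [Finset.mem_filter, Finset.mem_univ, true_and]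
  exact hD.existsUnique s (fun _ _ => rfl) hs

/-- Every nonconstant tuple is a unique rotation of a unique element of `T`, so its rotation class
contributes `p` equal terms. -/
theorem sum_nonconst_tuples [Fact p.Prime] {A R : Type*} [Fintype A] [DecidableEq A] [CommRing R]
    (F : (ZMod p → A) → R) (hF : ∀ s c, F (fun i => s (i + c)) = F s) (T : Finset (ZMod p → A))
    (hT : ∀ s ∈ T, ¬ IsConstTuple s)
    (hT' : ∀ s : ZMod p → A, ¬ IsConstTuple s → ∃! c : ZMod p, (fun i => s (i + c)) ∈ T) :
    ∑ s, F s = ∑ a, F (fun _ => a) + p * ∑ s ∈ T, F s := by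
  classical
  rw [← Finset.sum_filter_add_sum_filter_not Finset.univ IsConstTuple]
  congr 1
  · symm
    refine Finset.sum_bij (fun a _ _ => a) ?_ ?_ ?_ ?_
    · intro a _
      exact Finset.mem_filter.2 ⟨Finset.mem_univ _, fun _ _ => rfl⟩
    · intro a _ b _ h
      exact congrFun h 0
    · intro s hs
      exact ⟨s 0, Finset.mem_univ _, funext fun i => (Finset.mem_filter.1 hs).2 0 i⟩
    · intros
      rfl
  · have : (p : R) * ∑ s ∈ T, F s = ∑ x ∈ T ×ˢ (Finset.univ : Finset (ZMod p)), F x.1 := by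
      rw [Finset.sum_product_right]
      simp [ZMod.card]
    rw [this]
    symm
    refine Finset.sum_bij (fun x _ i => x.1 (i + x.2)) ?_ ?_ ?_ ?_
    · rintro ⟨s, c⟩ h
      simpa [isConstTuple_rotate c s] using hT s (Finset.mem_product.1 h).1
    · rintro ⟨s, c⟩ h ⟨s', c'⟩ h' heq
      have h1 := (Finset.mem_product.1 h).1
      have h2 := (Finset.mem_product.1 h').1
      obtain ⟨d, -, hd⟩ := hT' _ (mt (isConstTuple_rotate c s).1 (hT s h1))
      have e1 := hd (-c) (by simpa using h1)
      have e2 := hd (-c') (by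
        have := congrArg (fun t : ZMod p → A => fun i => t (i + -c')) heq
        simp only [neg_add_cancel_right] at this
        simpa [this] using h2)
      obtain rfl : c = c' := neg_injective (e1.trans e2.symm)
      refine Prod.ext (funext fun i => ?_) rfl
      simpa using congrFun heq (i - c)
    · intro s hs
      obtain ⟨c, hc, -⟩ := hT' s (Finset.mem_filter.1 hs).2
      exact ⟨(_, -c), Finset.mem_product.2 ⟨hc, Finset.mem_univ _⟩, by simp⟩
    · rintro ⟨s, c⟩ -
      exact (hF s c).symm

/-- Indexing the cross terms by `T` gives the quotient by `p` the same shape as the mixed tuples in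
`subClass_rotationDomain_add`. -/
theorem add_pow_eq_of_rotation_representatives [Fact p.Prime] {R : Type*} [CommRing R] (x y : R)
    (T : Finset (ZMod p → Bool)) (hT : ∀ s ∈ T, ¬ IsConstTuple s)
    (hT' : ∀ s : ZMod p → Bool, ¬ IsConstTuple s → ∃! c : ZMod p, (fun i => s (i + c)) ∈ T) :
    (x + y) ^ p = x ^ p + y ^ p + p * ∑ s ∈ T, ∏ i, (bif s i then x else y) := by
  have h := sum_nonconst_tuples (fun s : ZMod p → Bool => ∏ i, (bif s i then x else y))
    (fun s c => Equiv.prod_comp (Equiv.addRight c) fun i => (bif s i then x else y)) T hT hT'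
  simp only [Fintype.sum_bool, cond_true, cond_false, Finset.prod_const, Finset.card_univ,
    ZMod.card] at h
  rw [← h, ← Fintype.prod_sum (f := fun (_ : ZMod p) (b : Bool) => (bif b then x else y))]
  simp [ZMod.card]

end Tuples

/-! ### Classes of rotation domains and their behavior under the relations. -/

section RotationDomains

variable {p : ℕ} [hp : Fact p.Prime] {G : Type u} [Group G] (𝓔 : Set (Subgroup G))
  [HasSmoothProducts 𝓔]
  {Y X : Type u} [MulAction G Y] [MulAction G X]
  [IsSmoothSet 𝓔 Y] [IsSmoothSet 𝓔 X] [Nonempty X] [MulAction.IsPretransitive G X]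

/-- Cut `D` according to which rotation moves a tuple into `D'`, and rotate the pieces. The map to
`X` is unchanged because each tuple lies in a single fiber. -/
theorem subClass_eq_of_isRotationDomain (f : Y →[G] X) {D D' : SubMulAction G (ZMod p → Y)}
    (hD : IsRotationDomain f D) (hD' : IsRotationDomain f D') :
    subClass 𝓔 (powMap p f) D = subClass 𝓔 (powMap p f) D' := by
  have key : ∀ {D D' : SubMulAction G (ZMod p → Y)}, IsRotationDomain f D →
      IsRotationDomain f D' → subClass 𝓔 (powMap p f) D =
        ∑ c : ZMod p, subClass 𝓔 (powMap p f) (D ⊓ preimageSub (rotate G c) D') := by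
    intro D D' hD hD'
    refine subClass_sum 𝓔 _ _ _ _ (fun t => ⟨fun ht => ?_, ?_⟩) ?_
    · obtain ⟨c, hc, -⟩ := hD'.existsUnique t (hD.fiber t ht) (hD.nonconst t ht)
      exact ⟨c, Finset.mem_univ _, ht, hc⟩
    · rintro ⟨c, -, ht, -⟩
      exact ht
    · rintro c - d - t ⟨ht, hc⟩ ⟨-, hd⟩
      exact (hD'.existsUnique t (hD.fiber t ht) (hD.nonconst t ht)).unique hc hd
  rw [key hD hD', key hD' hD]
  refine Fintype.sum_equiv (Equiv.neg _) _ _ fun c => ?_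
  symm
  refine subClass_congr 𝓔 _ _ _ _ (rotate G c) ⟨?_, ?_, ?_⟩ ?_
  · rintro t ⟨h1, h2⟩
    exact ⟨h2, by simpa using h1⟩
  · intro s _ t _ h
    simpa using congrArg (rotate G (-c)) h
  · rintro t ⟨h1, h2⟩
    exact ⟨rotate G (-c) t, ⟨h2, by simpa using h1⟩, by simp⟩
  · rintro t ⟨h1, -⟩
    exact hD.fiber t h1 _ _

/-- The fiber power `F` is the disjoint union of the diagonal `C` and the nonconstant tuples `N`,
and `N` is tiled by the `p` rotations of `D`. -/
theorem thetaClass_pow_eq (f : Y →[G] X) {D : SubMulAction G (ZMod p → Y)}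
    (hD : IsRotationDomain f D) :
    thetaClass 𝓔 f ^ p = thetaClass 𝓔 f + p * subClass 𝓔 (powMap p f) D := by
  let F : SubMulAction G (ZMod p → Y) := ⟨{t | IsConstTuple fun i => f (t i)}, fun g t ht i j => by
    simpa using ht i j⟩
  let C : SubMulAction G (ZMod p → Y) := ⟨{t | IsConstTuple t}, fun g t ht i j => by
    simpa using ht i j⟩
  let N : SubMulAction G (ZMod p → Y) :=
    ⟨{t | (IsConstTuple fun i => f (t i)) ∧ ¬ IsConstTuple t}, fun g t ht =>
      ⟨F.smul_mem g ht.1, fun h => ht.2 (inv_smul_smul g t ▸ C.smul_mem g⁻¹ h :)⟩⟩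
  have hF : subClass 𝓔 (powMap p f) F = thetaClass 𝓔 f ^ p := by
    rw [subClass, thetaClass_fiberProduct 𝓔 (fun _ : ZMod p => Y) (fun _ => f) F _
      (fun i => ⟨fun t => t.1 i, fun _ _ => rfl⟩) ⟨fun i t => t.2 i 0, fun x y hy => ?_⟩]
    · simp [ZMod.card]
    · exact ⟨⟨y, fun i j => (hy i).trans (hy j).symm⟩, ⟨hy 0, fun _ => rfl⟩,
        fun b hb => Subtype.ext (funext hb.2)⟩
  have hC : subClass 𝓔 (powMap p f) C = thetaClass 𝓔 f := by
    refine subClass_eq_thetaClass 𝓔 _ _ _ ⟨fun y _ => y, fun _ _ => rfl⟩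
      (fun a b h => congrFun h 0) (fun t => ⟨fun ht => ⟨t 0, funext fun i => ht 0 i⟩, ?_⟩)
      fun _ => rfl
    rintro ⟨y, rfl⟩ _ _
    rfl
  have hN : subClass 𝓔 (powMap p f) N = p * subClass 𝓔 (powMap p f) D := by
    rw [subClass_sum 𝓔 _ (Finset.univ : Finset (ZMod p)) N (fun c => preimageSub (rotate G c) D)]
    · have : ∀ c : ZMod p, subClass 𝓔 (powMap p f) (preimageSub (rotate G c) D) =
          subClass 𝓔 (powMap p f) D := by
        intro c
        refine subClass_congr 𝓔 _ _ _ _ (rotate G (-c)) ⟨?_, ?_, ?_⟩ ?_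
        · intro t ht
          simpa using ht
        · intro s _ t _ h
          simpa using congrArg (rotate G c) h
        · intro t ht
          exact ⟨rotate G c t, ht, by simp⟩
        · intro t ht
          exact hD.fiber t ht _ _
      simp [this, ZMod.card]
    · intro t
      constructor
      · intro ht
        obtain ⟨c, hc, -⟩ := hD.existsUnique t ht.1 ht.2
        exact ⟨c, Finset.mem_univ _, hc⟩
      · rintro ⟨c, -, hc⟩
        exact ⟨(isConstTuple_rotate c fun i => f (t i)).1 (hD.fiber _ hc),
          mt (isConstTuple_rotate c t).2 (hD.nonconst _ hc)⟩
    · intro c _ d _ t hc hd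
      exact (hD.existsUnique t ((isConstTuple_rotate c fun i => f (t i)).1 (hD.fiber _ hc))
        (mt (isConstTuple_rotate c t).2 (hD.nonconst _ hc))).unique hc hd
  rw [← hF, ← hC, ← hN]
  refine subClass_union 𝓔 _ F C N (fun t => ⟨fun ht => ?_, ?_⟩) fun t ht ht' => ht'.2 ht
  · by_cases h : IsConstTuple t
    · exact .inl h
    · exact .inr ⟨ht, h⟩
  · rintro (ht | ht)
    · exact fun i j => congrArg f (ht i j)
    · exact ht.1

theorem subClass_rotationDomain_of_injective (f : Y →[G] X) (hf : Function.Injective f)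
    {D : SubMulAction G (ZMod p → Y)} (hD : IsRotationDomain f D) :
    subClass 𝓔 (powMap p f) D = 0 :=
  subClass_of_empty 𝓔 _ _ fun t ht => hD.nonconst t ht fun i j => hf (hD.fiber t ht i j)

/-- The pullback `E` of `D` is a rotation domain for `f'`, and `E → X'` is the base change of `D →
X`; independence of the domain does the rest. -/
theorem subClass_rotationDomain_baseChange {Y' X' : Type u} [MulAction G Y'] [MulAction G X']
    [IsSmoothSet 𝓔 Y'] [IsSmoothSet 𝓔 X'] [Nonempty X'] [MulAction.IsPretransitive G X']
    (f : Y →[G] X) (g : X' →[G] X) (f' : Y' →[G] X') (g' : Y' →[G] Y)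
    (comm : ∀ y' : Y', f (g' y') = g (f' y'))
    (cartesian : ∀ (y : Y) (x' : X'), f y = g x' → ∃! y' : Y', g' y' = y ∧ f' y' = x')
    {D : SubMulAction G (ZMod p → Y)} {D' : SubMulAction G (ZMod p → Y')}
    (hD : IsRotationDomain f D) (hD' : IsRotationDomain f' D') :
    subClass 𝓔 (powMap p f) D = subClass 𝓔 (powMap p f') D' := by
  let E : SubMulAction G (ZMod p → Y') :=
    ⟨{t | (IsConstTuple fun i => f' (t i)) ∧ (fun i => g' (t i)) ∈ D}, fun k t ht =>
      ⟨fun i j => by simpa using ht.1 i j, by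
        have := D.smul_mem k ht.2
        simpa [Pi.smul_def] using this⟩⟩
  have hE : IsRotationDomain f' E := by
    refine ⟨fun t ht => ht.1, fun t ht h => hD.nonconst _ ht.2 fun i j => congrArg g' (h i j),
      fun t ht ht' => ?_⟩
    obtain ⟨c, hc, hu⟩ := hD.existsUnique (fun i => g' (t i))
      (fun i j => by simp only [comm, ht i j]) fun h => ht' fun i j =>
        (cartesian (g' (t j)) (f' (t j)) (comm _)).unique ⟨h i j, ht i j⟩ ⟨rfl, rfl⟩
    exact ⟨c, ⟨(isConstTuple_rotate c fun i => f' (t i)).2 ht, hc⟩, fun d hd => hu d hd.2⟩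
  rw [subClass_eq_of_isRotationDomain 𝓔 f' hD' hE]
  refine thetaClass_baseChange 𝓔 _ g _
    (⟨fun t => ⟨fun i => g' (t.1 i), t.2.2⟩, fun k t => Subtype.ext (funext fun i => ?_)⟩ :
      E →[G] D) (fun t => comm _) ?_
  · exact map_smul g' k (t.1 i)
  · rintro ⟨t, ht⟩ x' hx'
    have h1 : ∀ i, f (t i) = g x' := fun i => (hD.fiber t ht i 0).trans hx'
    choose s hs hs' using fun i => cartesian (t i) x' (h1 i)
    have hst : (fun i => g' (s i)) = t := funext fun i => (hs i).1
    refine ⟨⟨s, fun i j => (hs i).2.trans (hs j).2.symm, hst.symm ▸ ht⟩,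
      ⟨Subtype.ext hst, (hs 0).2⟩, ?_⟩
    rintro ⟨r, hr⟩ ⟨hr1, hr2⟩
    exact Subtype.ext (funext fun i => hs' i _ ⟨congrFun (congrArg Subtype.val hr1) i,
      (hr.1 i 0).trans hr2⟩)

/-- A nonconstant tuple in a fiber of `f ∘ g` either has nonconstant image under `g`, and is then
normalized through `D`, or lies in one fiber of `g`, and is then normalized through `D'`. -/
theorem subClass_rotationDomain_comp {Z : Type u} [MulAction G Z] [IsSmoothSet 𝓔 Z] [Nonempty Y]
    [MulAction.IsPretransitive G Y] (f : Y →[G] X) (g : Z →[G] Y)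
    {D : SubMulAction G (ZMod p → Y)} {D' E : SubMulAction G (ZMod p → Z)}
    (hD : IsRotationDomain f D) (hD' : IsRotationDomain g D')
    (hE : IsRotationDomain (f.comp g) E) :
    subClass 𝓔 (powMap p (f.comp g)) E = subClass 𝓔 (powMap p f) D * thetaClass 𝓔 g ^ p +
      thetaClass 𝓔 f * subClass 𝓔 (powMap p g) D' := by
  let gp : (ZMod p → Z) →[G] (ZMod p → Y) :=
    ⟨fun t i => g (t i), fun k t => funext fun i => map_smul g k (t i)⟩
  have hdisj : ∀ t ∈ preimageSub gp D, t ∉ D' := fun t ht ht' => hD.nonconst _ ht (hD'.fiber t ht')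
  let E' : SubMulAction G (ZMod p → Z) := ⟨{t | t ∈ preimageSub gp D ∨ t ∈ D'}, fun k t ht =>
    ht.imp (SubMulAction.smul_mem _ k) (SubMulAction.smul_mem _ k)⟩
  have hE' : IsRotationDomain (f.comp g) E' := by
    refine ⟨?_, ?_, ?_⟩
    · rintro t (ht | ht) i j
      · exact hD.fiber _ ht i j
      · exact congrArg f (hD'.fiber _ ht i j)
    · rintro t (ht | ht) h
      · exact hD.nonconst _ ht fun i j => congrArg g (h i j)
      · exact hD'.nonconst _ ht h
    · intro t ht ht'
      by_cases h : IsConstTuple fun i => g (t i)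
      · obtain ⟨c, hc, hu⟩ := hD'.existsUnique t h ht'
        refine ⟨c, .inr hc, ?_⟩
        rintro d (hd | hd)
        · exact absurd ((isConstTuple_rotate d fun i => g (t i)).2 h) (hD.nonconst _ hd)
        · exact hu d hd
      · obtain ⟨c, hc, hu⟩ := hD.existsUnique (fun i => g (t i)) ht h
        refine ⟨c, .inl hc, ?_⟩
        rintro d (hd | hd)
        · exact hu d hd
        · exact absurd ((isConstTuple_rotate d fun i => g (t i)).1 (hD'.fiber _ hd)) h
  rw [subClass_eq_of_isRotationDomain 𝓔 _ hE hE',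
    subClass_union 𝓔 _ E' (preimageSub gp D) D' (fun _ => Iff.rfl) hdisj]
  congr 1
  · refine thetaClass_comp_of_const 𝓔 ((powMap p f).comp D.subtype) (restrictSub gp D) _ fun o => ?_
    -- `A i` is the base change of `g` along the `i`-th entry `o → Y`. The fiber product of all `p`
    -- of them over `o` is the part of `preimageSub gp D` above `o`, whence the factor `[g] ^ p`.
    let A : ZMod p → SubMulAction G (orbitSub o × Z) := fun i =>
      ⟨{a | a.1.1.1 i = g a.2}, fun k a ha => by
        simp only [Set.mem_ofPred_eq] at ha
        simp [ha]⟩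
    let q : ∀ i, A i →[G] orbitSub o := fun i => ⟨fun a => a.1.1, fun _ _ => rfl⟩
    have hq : ∀ i, thetaClass 𝓔 (q i) = thetaClass 𝓔 g := by
      intro i
      symm
      refine thetaClass_baseChange 𝓔 g (⟨fun a => a.1.1 i, fun _ _ => rfl⟩ : orbitSub o →[G] Y) _
        (⟨fun a => a.1.2, fun _ _ => rfl⟩ : A i →[G] Z) (fun a => a.2.symm) ?_
      intro z a hza
      exact ⟨⟨(a, z), hza.symm⟩, ⟨rfl, rfl⟩, fun b hb => Subtype.ext (Prod.ext hb.2 hb.1)⟩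
    let ρ : ∀ i, preimageSub (restrictSub gp D) (orbitSub o) →[G] A i := fun i =>
      ⟨fun t => ⟨(restrictSub (restrictSub gp D) (orbitSub o) t, t.1.1 i), rfl⟩, fun k t =>
        Subtype.ext (Prod.ext (map_smul (restrictSub (restrictSub gp D) (orbitSub o)) k t) rfl)⟩
    rw [thetaClass_fiberProduct 𝓔 (fun i => A i) q _
      (restrictSub (restrictSub gp D) (orbitSub o)) ρ ⟨?_, ?_⟩]
    · simp [hq, ZMod.card]
    · intro i a
      rfl
    · rintro ⟨⟨t, ht⟩, hto⟩ y hy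
      have h1 : ∀ i, g (y i).1.2 = t i := fun i => by
        rw [← (y i).2]
        exact congrArg (fun a : orbitSub o => a.1.1 i) (hy i)
      have h2 : gp (fun i => (y i).1.2) = t := funext h1
      subst h2
      refine ⟨⟨⟨fun i => (y i).1.2, ht⟩, hto⟩, ⟨rfl, fun i => ?_⟩, ?_⟩
      · exact Subtype.ext (Prod.ext (hy i).symm rfl)
      · rintro ⟨⟨s, hs⟩, hso⟩ ⟨-, hb⟩
        refine Subtype.ext (Subtype.ext (funext fun i => ?_))
        exact congrArg (fun a => a.1.2) (hb i)
  · exact thetaClass_comp 𝓔 f ((powMap p g).comp D'.subtype)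

/-- Color each entry by the summand containing it. One-colored tuples are handled by `D₁` and `D₂`;
mixed ones are normalized by rotating their color pattern into `T`, and those of a fixed pattern
form a fiber product of copies of `Y₁` and `Y₂`. -/
theorem subClass_rotationDomain_add {Y₁ Y₂ : Type u} [MulAction G Y₁] [MulAction G Y₂]
    [IsSmoothSet 𝓔 Y₁] [IsSmoothSet 𝓔 Y₂] (f : Y →[G] X) (i₁ : Y₁ →[G] Y) (i₂ : Y₂ →[G] Y)
    (h : Function.Bijective (Sum.elim i₁ i₂))
    {D : SubMulAction G (ZMod p → Y)} {D₁ : SubMulAction G (ZMod p → Y₁)}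
    {D₂ : SubMulAction G (ZMod p → Y₂)} (hD : IsRotationDomain f D)
    (hD₁ : IsRotationDomain (f.comp i₁) D₁) (hD₂ : IsRotationDomain (f.comp i₂) D₂)
    (T : Finset (ZMod p → Bool)) (hT : ∀ s ∈ T, ¬ IsConstTuple s)
    (hT' : ∀ s : ZMod p → Bool, ¬ IsConstTuple s → ∃! c : ZMod p, (fun i => s (i + c)) ∈ T) :
    subClass 𝓔 (powMap p f) D =
      subClass 𝓔 (powMap p (f.comp i₁)) D₁ + subClass 𝓔 (powMap p (f.comp i₂)) D₂ +
      ∑ s ∈ T, ∏ i, (bif s i then thetaClass 𝓔 (f.comp i₁) else thetaClass 𝓔 (f.comp i₂)) := by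
  classical
  have hinj₁ : Function.Injective i₁ := fun a b hab => Sum.inl_injective (h.1 hab)
  have hinj₂ : Function.Injective i₂ := fun a b hab => Sum.inr_injective (h.1 hab)
  have hne : ∀ a b, i₁ a ≠ i₂ b := fun a b hab =>
    Sum.inl_ne_inr (h.1 (a₁ := .inl a) (a₂ := .inr b) hab)
  have hcov : ∀ y, (∃ a, i₁ a = y) ∨ ∃ b, i₂ b = y := fun y => by
    obtain ⟨a | b, hab⟩ := h.2 y
    · exact .inl ⟨a, hab⟩
    · exact .inr ⟨b, hab⟩
  let col : Y → Bool := fun y => decide (∃ a, i₁ a = y)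
  have col₁ : ∀ a, col (i₁ a) = true := fun a => decide_eq_true ⟨a, rfl⟩
  have col₂ : ∀ b, col (i₂ b) = false := fun b => decide_eq_false fun ⟨a, ha⟩ => hne a b ha
  have hcol₁ : ∀ y, col y = true → ∃ a, i₁ a = y := fun y hy => of_decide_eq_true hy
  have hcol₂ : ∀ y, col y = false → ∃ b, i₂ b = y := fun y hy =>
    (hcov y).resolve_left (of_decide_eq_false hy)
  have col_smul : ∀ (g : G) y, col (g • y) = col y := by
    intro g y
    rcases hcov y with ⟨a, rfl⟩ | ⟨b, rfl⟩
    · rw [← map_smul, col₁, col₁]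
    · rw [← map_smul, col₂, col₂]
  let j₁ : (ZMod p → Y₁) →[G] (ZMod p → Y) :=
    ⟨fun t i => i₁ (t i), fun k t => funext fun i => map_smul i₁ k (t i)⟩
  let j₂ : (ZMod p → Y₂) →[G] (ZMod p → Y) :=
    ⟨fun t i => i₂ (t i), fun k t => funext fun i => map_smul i₂ k (t i)⟩
  have hj₁ : Function.Injective j₁ := fun a b hab => funext fun i => hinj₁ (congrFun hab i)
  have hj₂ : Function.Injective j₂ := fun a b hab => funext fun i => hinj₂ (congrFun hab i)
  let E₁ : SubMulAction G (ZMod p → Y) := ⟨{t | ∃ s ∈ D₁, j₁ s = t}, by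
    rintro k _ ⟨s, hs, rfl⟩
    exact ⟨k • s, D₁.smul_mem k hs, map_smul j₁ k s⟩⟩
  let E₂ : SubMulAction G (ZMod p → Y) := ⟨{t | ∃ s ∈ D₂, j₂ s = t}, by
    rintro k _ ⟨s, hs, rfl⟩
    exact ⟨k • s, D₂.smul_mem k hs, map_smul j₂ k s⟩⟩
  let K : (ZMod p → Bool) → SubMulAction G (ZMod p → Y) := fun s =>
    ⟨{t | (IsConstTuple fun i => f (t i)) ∧ ∀ i, col (t i) = s i}, fun k t ht =>
      ⟨fun i j => by simpa using ht.1 i j, fun i => (col_smul k (t i)).trans (ht.2 i)⟩⟩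
  let E₃ : SubMulAction G (ZMod p → Y) := ⟨{t | ∃ s ∈ T, t ∈ K s}, fun k t ⟨s, hs, ht⟩ =>
    ⟨s, hs, (K s).smul_mem k ht⟩⟩
  let E₁₂ : SubMulAction G (ZMod p → Y) := ⟨{t | t ∈ E₁ ∨ t ∈ E₂}, fun k t ht =>
    ht.imp (SubMulAction.smul_mem _ k) (SubMulAction.smul_mem _ k)⟩
  let E : SubMulAction G (ZMod p → Y) := ⟨{t | t ∈ E₁₂ ∨ t ∈ E₃}, fun k t ht =>
    ht.imp (SubMulAction.smul_mem _ k) (SubMulAction.smul_mem _ k)⟩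
  have cE₁ : ∀ t ∈ E₁, ∀ i, col (t i) = true := by
    rintro _ ⟨s, -, rfl⟩ i
    exact col₁ (s i)
  have cE₂ : ∀ t ∈ E₂, ∀ i, col (t i) = false := by
    rintro _ ⟨s, -, rfl⟩ i
    exact col₂ (s i)
  have cE₃ : ∀ t ∈ E₃, ¬ IsConstTuple fun i => col (t i) := by
    rintro t ⟨s, hs, -, hts⟩
    rw [funext hts]
    exact hT s hs
  have hE : IsRotationDomain f E := by
    refine ⟨?_, ?_, ?_⟩
    · rintro t ((⟨s, hs, rfl⟩ | ⟨s, hs, rfl⟩) | ⟨s, -, ht, -⟩)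
      · exact hD₁.fiber s hs
      · exact hD₂.fiber s hs
      · exact ht
    · rintro t ((⟨s, hs, rfl⟩ | ⟨s, hs, rfl⟩) | ht) hc
      · exact hD₁.nonconst s hs fun i j => hinj₁ (hc i j)
      · exact hD₂.nonconst s hs fun i j => hinj₂ (hc i j)
      · exact cE₃ t ht fun i j => congrArg col (hc i j)
    · intro t ht ht'
      by_cases hc : IsConstTuple fun i => col (t i)
      · rcases hb : col (t 0) with _ | _
        · choose s hs using fun i => hcol₂ (t i) ((hc i 0).trans hb)
          obtain rfl : j₂ s = t := funext hs
          obtain ⟨c, hc', hu⟩ := hD₂.existsUnique s ht fun hcs => ht' fun i j =>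
            congrArg i₂ (hcs i j)
          refine ⟨c, .inl (.inr ⟨_, hc', rfl⟩), ?_⟩
          rintro d ((hd | ⟨r, hr, hrs⟩) | hd)
          · have := cE₁ _ hd 0
            exact absurd (this.symm.trans (col₂ _)) (by decide)
          · obtain rfl : r = rotate G d s := hj₂ hrs
            exact hu d hr
          · exact absurd ((isConstTuple_rotate d fun i => col (j₂ s i)).2 hc) (cE₃ _ hd)
        · choose s hs using fun i => hcol₁ (t i) ((hc i 0).trans hb)
          obtain rfl : j₁ s = t := funext hs
          obtain ⟨c, hc', hu⟩ := hD₁.existsUnique s ht fun hcs => ht' fun i j =>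
            congrArg i₁ (hcs i j)
          refine ⟨c, .inl (.inl ⟨_, hc', rfl⟩), ?_⟩
          rintro d ((⟨r, hr, hrs⟩ | hd) | hd)
          · obtain rfl : r = rotate G d s := hj₁ hrs
            exact hu d hr
          · have := cE₂ _ hd 0
            exact absurd (this.symm.trans (col₁ _)) (by decide)
          · exact absurd ((isConstTuple_rotate d fun i => col (j₁ s i)).2 hc) (cE₃ _ hd)
      · obtain ⟨c, hc', hu⟩ := hT' _ hc
        refine ⟨c, .inr ⟨_, hc', (isConstTuple_rotate c fun i => f (t i)).2 ht, fun _ => rfl⟩, ?_⟩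
        rintro d ((hd | hd) | ⟨s, hs, -, hds⟩)
        · exact absurd ((isConstTuple_rotate d fun i => col (t i)).1
            fun i j => (cE₁ _ hd i).trans (cE₁ _ hd j).symm) hc
        · exact absurd ((isConstTuple_rotate d fun i => col (t i)).1
            fun i j => (cE₂ _ hd i).trans (cE₂ _ hd j).symm) hc
        · refine hu d ?_
          rwa [← funext hds] at hs
  have e₁ : subClass 𝓔 (powMap p f) E₁ = subClass 𝓔 (powMap p (f.comp i₁)) D₁ :=
    subClass_congr 𝓔 _ _ _ _ j₁ ⟨fun s hs => ⟨s, hs, rfl⟩, hj₁.injOn, fun t ht => ht⟩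
      fun _ _ => rfl
  have e₂ : subClass 𝓔 (powMap p f) E₂ = subClass 𝓔 (powMap p (f.comp i₂)) D₂ :=
    subClass_congr 𝓔 _ _ _ _ j₂ ⟨fun s hs => ⟨s, hs, rfl⟩, hj₂.injOn, fun t ht => ht⟩
      fun _ _ => rfl
  let B : Bool → SubMulAction G Y := fun b => ⟨{y | col y = b}, fun k y hy =>
    (col_smul k y).trans hy⟩
  have hB : ∀ b, subClass 𝓔 f (B b) =
      bif b then thetaClass 𝓔 (f.comp i₁) else thetaClass 𝓔 (f.comp i₂) := by
    rintro (_ | _)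
    · refine subClass_eq_thetaClass 𝓔 _ _ _ i₂ hinj₂ (fun y => ⟨hcol₂ y, ?_⟩) fun _ => rfl
      rintro ⟨b, rfl⟩
      exact col₂ b
    · refine subClass_eq_thetaClass 𝓔 _ _ _ i₁ hinj₁ (fun y => ⟨hcol₁ y, ?_⟩) fun _ => rfl
      rintro ⟨b, rfl⟩
      exact col₁ b
  have e₃ : subClass 𝓔 (powMap p f) E₃ =
      ∑ s ∈ T, ∏ i, (bif s i then thetaClass 𝓔 (f.comp i₁) else thetaClass 𝓔 (f.comp i₂)) := by
    rw [subClass_sum 𝓔 _ T E₃ K (fun _ => Iff.rfl)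
      (fun s _ s' _ t ht ht' => funext fun i => (ht.2 i).symm.trans (ht'.2 i))]
    refine Finset.sum_congr rfl fun s _ => ?_
    simp only [← hB]
    refine thetaClass_fiberProduct 𝓔 (fun i => B (s i)) (fun i => f.comp (B (s i)).subtype) (K s) _
      (fun i => ⟨fun t => ⟨t.1 i, t.2.2 i⟩, fun _ _ => rfl⟩) ⟨fun i t => t.2.1 i 0, ?_⟩
    intro x y hy
    refine ⟨⟨fun i => y i, fun i j => (hy i).trans (hy j).symm, fun i => (y i).2⟩,
      ⟨hy 0, fun _ => rfl⟩, ?_⟩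
    rintro b ⟨-, hb⟩
    exact Subtype.ext (funext fun i => congrArg Subtype.val (hb i))
  rw [subClass_eq_of_isRotationDomain 𝓔 f hD hE, ← e₁, ← e₂, ← e₃,
    subClass_union 𝓔 _ E E₁₂ E₃ (fun _ => Iff.rfl), subClass_union 𝓔 _ E₁₂ E₁ E₂ (fun _ => Iff.rfl)]
  · intro t h1 h2
    exact absurd ((cE₁ t h1 0).symm.trans (cE₂ t h2 0)) (by decide)
  · rintro t (h1 | h1) h2
    · exact cE₃ t h2 fun i j => (cE₁ t h1 i).trans (cE₁ t h1 j).symm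
    · exact cE₃ t h2 fun i j => (cE₂ t h1 i).trans (cE₂ t h1 j).symm

end RotationDomains

/-! ### The Frobenius lift on the polynomial ring. -/

section FrobeniusOnTheta

variable {p : ℕ} [hp : Fact p.Prime] {G : Type u} [Group G] (𝓔 : Set (Subgroup G))
  [HasSmoothProducts 𝓔]

/-- The formulas for rotation domains are exactly the comparisons of correction terms required for
the four kinds of relations. -/
theorem theta_pow_sub_self_and_torsionFree
    (hfree : ∀ (Y : SmoothGSet G 𝓔) (t : ZMod p → Y) (g : G) (c : ZMod p),
      (∀ i, g • t i = t (i + c)) → c ≠ 0 → IsConstTuple t) :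
    (∀ x : Theta G 𝓔, (p : Theta G 𝓔) ∣ x ^ p - x) ∧
    (∀ x : Theta G 𝓔, (p : Theta G 𝓔) * x = 0 → x = 0) := by
  choose D hD using fun F : MapToTransitive G 𝓔 =>
    exists_isRotationDomain (p := p) F.map (hfree F.source)
  let q : MapToTransitive G 𝓔 → MvPolynomial (MapToTransitive G 𝓔) ℤ := fun F =>
    mapSymbol (Y := .of 𝓔 (D F)) F.transitive ((powMap p F.map).comp (D F).subtype)
  let φ : MvPolynomial (MapToTransitive G 𝓔) ℤ →+* MvPolynomial (MapToTransitive G 𝓔) ℤ :=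
    MvPolynomial.eval₂Hom MvPolynomial.C fun F =>
      MvPolynomial.X F ^ p - (p : MvPolynomial (MapToTransitive G 𝓔) ℤ) * q F
  have hφX : ∀ F, φ (MvPolynomial.X F) =
      MvPolynomial.X F ^ p - (p : MvPolynomial (MapToTransitive G 𝓔) ℤ) * q F := fun F =>
    MvPolynomial.eval₂Hom_X' _ _ F
  have hφS : ∀ {Y X : SmoothGSet G 𝓔} (hX : X.IsTransitive) (f : Y →[G] X),
      φ (mapSymbol hX f) = mapSymbol hX f ^ p + p * (-q ⟨hX, f⟩) := fun hX f => by
    rw [mapSymbol, hφX]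
    ring
  have hmk : ∀ a b : MvPolynomial (MapToTransitive G 𝓔) ℤ,
      a - b ∈ Ideal.span {r : MvPolynomial (MapToTransitive G 𝓔) ℤ | IsThetaRelation r} ↔
        (Ideal.Quotient.mk _ a : Theta G 𝓔) = Ideal.Quotient.mk _ b := fun a b =>
    (Ideal.Quotient.mk_eq_mk_iff_sub_mem a b).symm
  have hpow : ∀ F : MapToTransitive G 𝓔, (Ideal.Quotient.mk _ (MvPolynomial.X F) : Theta G 𝓔) ^ p =
      Ideal.Quotient.mk _ (MvPolynomial.X F) + (p : Theta G 𝓔) * Ideal.Quotient.mk _ (q F) := by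
    intro F
    have := F.transitive.1
    have := F.transitive.2
    exact thetaClass_pow_eq 𝓔 F.map (hD F)
  refine dvd_sub_and_torsionFree_of_frobenius_lift hp.out
    (fun x y h => mul_left_cancel₀ (Nat.cast_ne_zero.2 hp.out.ne_zero) h) _ φ ?_ ?_ ?_
  · intro x
    induction x using MvPolynomial.induction_on with
    | C a =>
      have h1 : (p : ℤ) ∣ a - a ^ p := by
        rw [← ZMod.intCast_zmod_eq_zero_iff_dvd]
        push_cast
        rw [ZMod.pow_card, sub_self]
      have h2 := map_dvd (MvPolynomial.C (σ := MapToTransitive G 𝓔)) h1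
      simpa [φ] using h2
    | add x y hx hy =>
      obtain ⟨r, hr⟩ := exists_add_pow_prime_eq hp.out x y
      rw [map_add, hr]
      have h3 : (p : MvPolynomial (MapToTransitive G 𝓔) ℤ) ∣ p * x * y * r :=
        ⟨x * y * r, by ring⟩
      convert dvd_sub (dvd_add hx hy) h3 using 1
      ring
    | mul_X x F hx =>
      obtain ⟨r, hr⟩ := hx
      refine ⟨r * φ (MvPolynomial.X F) - x ^ p * q F, ?_⟩
      rw [map_mul, mul_pow]
      linear_combination φ (MvPolynomial.X F) * hr + x ^ p * hφX F
  · intro x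
    rw [hmk]
    refine RingHom.congr_fun (f := (Ideal.Quotient.mk _).comp φ) (g := Ideal.Quotient.mk _)
      (MvPolynomial.ringHom_ext (fun a => ?_) fun F => ?_) x
    · simp [φ]
    · rw [RingHom.comp_apply, hφX, map_sub, map_pow, map_mul, map_natCast, hpow]
      ring
  · intro r hr
    have hrI := Ideal.subset_span hr
    rcases hr with ⟨hX, f, hf⟩ | ⟨hX, f, i₁, i₂, h⟩ | ⟨hZ, hY, hX, f, g⟩ |
      ⟨hX, hX', f, g, f', g', comm, cartesian⟩
    · have := hX.1
      have := hX.2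
      refine exists_mem_frobenius_lift_sub hp.out φ hrI (hφS hX f) (β := 0) (by simp) ?_
      rw [hmk, map_zero, map_neg, neg_eq_zero]
      exact subClass_rotationDomain_of_injective 𝓔 f hf.1 (hD ⟨hX, f⟩)
    · have := hX.1
      have := hX.2
      obtain ⟨T, hT, hT'⟩ := exists_boolean_rotation_representatives p
      refine exists_mem_frobenius_lift_sub hp.out φ hrI (hφS hX f)
        (β := -(q ⟨hX, f.comp i₁⟩ + q ⟨hX, f.comp i₂⟩ + ∑ s ∈ T, ∏ i,
          (bif s i then mapSymbol hX (f.comp i₁) else mapSymbol hX (f.comp i₂)))) ?_ ?_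
      · rw [map_add, hφS, hφS, add_pow_eq_of_rotation_representatives _ _ T hT hT']
        ring
      · rw [hmk, map_neg, map_neg, neg_inj, map_add, map_add, map_sum]
        simp only [map_prod, Bool.apply_cond (Ideal.Quotient.mk _)]
        exact subClass_rotationDomain_add 𝓔 f i₁ i₂ h (hD ⟨hX, f⟩) (hD ⟨hX, f.comp i₁⟩)
          (hD ⟨hX, f.comp i₂⟩) T hT hT'
    · have := hX.1
      have := hX.2
      have := hY.1
      have := hY.2
      refine exists_mem_frobenius_lift_sub hp.out φ hrI (hφS hX (f.comp g))
        -- This is read off by expanding `φ [f] * φ [g]`. Substituting `[f] ^ p = [f] + p q_f` in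
        -- the quotient cancels the term with `p`.
        (β := p * q ⟨hX, f⟩ * q ⟨hY, g⟩ - mapSymbol hX f ^ p * q ⟨hY, g⟩ -
          q ⟨hX, f⟩ * mapSymbol hY g ^ p) ?_ ?_
      · rw [map_mul, hφS, hφS]
        ring
      · rw [hmk]
        simp only [map_neg, map_sub, map_mul, map_pow, map_natCast]
        have h1 := subClass_rotationDomain_comp 𝓔 f g (hD ⟨hX, f⟩) (hD ⟨hY, g⟩)
          (hD ⟨hX, f.comp g⟩)
        have h2 := thetaClass_pow_eq 𝓔 f (hD ⟨hX, f⟩)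
        change (Ideal.Quotient.mk _ (q ⟨hX, f.comp g⟩) : Theta G 𝓔) =
          Ideal.Quotient.mk _ (q ⟨hX, f⟩) * Ideal.Quotient.mk _ (mapSymbol hY g) ^ p +
            Ideal.Quotient.mk _ (mapSymbol hX f) * Ideal.Quotient.mk _ (q ⟨hY, g⟩) at h1
        change (Ideal.Quotient.mk _ (mapSymbol hX f) : Theta G 𝓔) ^ p =
          Ideal.Quotient.mk _ (mapSymbol hX f) +
            (p : Theta G 𝓔) * Ideal.Quotient.mk _ (q ⟨hX, f⟩) at h2
        linear_combination (Ideal.Quotient.mk _ (q ⟨hY, g⟩)) * h2 - h1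
    · have := hX.1
      have := hX.2
      have := hX'.1
      have := hX'.2
      refine exists_mem_frobenius_lift_sub hp.out φ hrI (hφS hX f) (hφS hX' f') ?_
      rw [hmk, map_neg, map_neg, neg_inj]
      exact subClass_rotationDomain_baseChange 𝓔 f g f' g' comm cartesian (hD ⟨hX, f⟩)
        (hD ⟨hX', f'⟩)

end FrobeniusOnTheta

/-! ### Consequences of oligomorphy and of the index condition. -/

section Oligomorphic

variable {G Ω : Type u} [Group G] [MulAction G Ω]

theorem IsOligomorphic.finite_orbits (hG : IsOligomorphic G Ω) (ι : Type*) [Finite ι] :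
    Finite (MulAction.orbitRel.Quotient G (ι → Ω)) := by
  obtain ⟨n, ⟨e⟩⟩ := Finite.exists_equiv_fin ι
  have := hG n
  refine Finite.of_surjective (α := MulAction.orbitRel.Quotient G (Fin n → Ω))
    (Quotient.map (fun t i => t (e i)) ?_) ?_
  · rintro _ t ⟨g, rfl⟩
    exact ⟨g, rfl⟩
  · rintro ⟨t⟩
    exact ⟨Quotient.mk'' fun i => t (e.symm i), congrArg (Quotient.mk _) (by simp)⟩

/-- The elements of an orbit of a smooth set are determined by tuples of bounded length. -/
theorem exists_tuple_code (Y : Type u) [MulAction G Y]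
    [hY : IsSmoothSet (pointStabilizerClass G Ω) Y] :
    ∃ (A : Finset Ω) (code : Y → A → Ω), ∀ (y y' : Y) (k : G),
      (Quotient.mk'' y : MulAction.orbitRel.Quotient G Y) = Quotient.mk'' y' →
        k • code y = code y' → k • y = y' := by
  classical
  have := hY.finitary
  have := Fintype.ofFinite (MulAction.orbitRel.Quotient G Y)
  choose A hA using fun o : MulAction.orbitRel.Quotient G Y => hY.stabilizer_mem o.out
  choose γ hγ using fun y : Y => Quotient.exact
    (Quotient.out_eq (Quotient.mk'' y : MulAction.orbitRel.Quotient G Y)).symm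
  have hγ' : ∀ y, γ y • (Quotient.mk'' y : MulAction.orbitRel.Quotient G Y).out = y := hγ
  -- The stabilizer of an orbit representative is some `G(A o)`, so the translate of `A o` by `γ y`
  -- pins down `y` in its orbit. Using the union of all `A o` gives one index set for all orbits.
  refine ⟨Finset.univ.biUnion A, fun y a => γ y • (a : Ω), fun y y' k h hk => ?_⟩
  have h1 : (γ y')⁻¹ * k * γ y ∈
      MulAction.stabilizer G (Quotient.mk'' y' : MulAction.orbitRel.Quotient G Y).out := by
    rw [hA, mem_fixingSubgroup_iff]
    intro a ha
    have := congrFun hk ⟨a, Finset.mem_biUnion.2 ⟨_, Finset.mem_univ _, ha⟩⟩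
    simp only [Pi.smul_apply] at this
    rw [mul_smul, mul_smul, this, inv_smul_smul]
  rw [MulAction.mem_stabilizer_iff, mul_smul, mul_smul, inv_smul_eq_iff, hγ' y', ← h, hγ' y] at h1
  exact h1

/-- The orbit of `(y, z)` is determined by the orbits of `y`, of `z` and of their concatenated
codes, so there are finitely many. Stabilizers intersect as `G(A) ∩ G(B) = G(A ∪ B)`. -/
theorem IsOligomorphic.hasSmoothProducts (hG : IsOligomorphic G Ω) :
    HasSmoothProducts (pointStabilizerClass G Ω) where
  top_mem := ⟨∅, by ext; simp⟩
  prod Y Z _ _ hY hZ := by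
    classical
    refine ⟨?_, ?_⟩
    · obtain ⟨A, a, ha⟩ := exists_tuple_code (Ω := Ω) (G := G) Y
      obtain ⟨B, b, hb⟩ := exists_tuple_code (Ω := Ω) (G := G) Z
      have := hY.finitary
      have := hZ.finitary
      have := hG.finite_orbits (A ⊕ B)
      let F : Y × Z → MulAction.orbitRel.Quotient G Y × MulAction.orbitRel.Quotient G Z ×
          MulAction.orbitRel.Quotient G (A ⊕ B → Ω) := fun x =>
        (Quotient.mk'' x.1, Quotient.mk'' x.2, Quotient.mk'' (Sum.elim (a x.1) (b x.2)))
      refine Finite.of_injective (fun o : MulAction.orbitRel.Quotient G (Y × Z) => F o.out) ?_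
      intro o o' h
      obtain ⟨h1, h2, h3⟩ : _ ∧ _ ∧ _ := by simpa only [F, Prod.mk.injEq] using h
      obtain ⟨k, hk⟩ := Quotient.exact h3
      rw [← Quotient.out_eq o, ← Quotient.out_eq o']
      refine Quotient.sound ⟨k, Prod.ext ?_ ?_⟩
      · exact ha _ _ k h1.symm (funext fun i => congrFun hk (.inl i))
      · exact hb _ _ k h2.symm (funext fun i => congrFun hk (.inr i))
    · rintro ⟨y, z⟩
      obtain ⟨A, hA⟩ := hY.stabilizer_mem y
      obtain ⟨B, hB⟩ := hZ.stabilizer_mem z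
      refine ⟨A ∪ B, ?_⟩
      rw [Finset.coe_union, fixingSubgroup_union, ← hA, ← hB]
      ext g
      simp [Prod.ext_iff, Subgroup.mem_inf]

/-- A fixed point is determined by the orbit of the tuple formed by `A` and that point: an element
matching two such tuples lies in `G(A)`, so it moves neither point. -/
theorem IsOligomorphic.finite_fixedPoints (hG : IsOligomorphic G Ω) (A : Finset Ω) :
    {ω : Ω | ∀ g ∈ fixingSubgroup G (A : Set Ω), g • ω = ω}.Finite := by
  have := hG.finite_orbits (Option A)
  refine Set.finite_coe_iff.1 (Finite.of_injective (fun ω =>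
    (Quotient.mk'' (fun i : Option A => i.elim (ω : Ω) (↑)) :
      MulAction.orbitRel.Quotient G (Option A → Ω))) ?_)
  rintro ⟨ω, hω⟩ ⟨ω', hω'⟩ h
  obtain ⟨g, hg⟩ := Quotient.exact h
  refine Subtype.ext ((congrFun hg none).symm.trans (hω' g ?_))
  rw [mem_fixingSubgroup_iff]
  exact fun a ha => congrFun hg (some ⟨a, ha⟩)

theorem pow_index_mem_fixingSubgroup (B : Set Ω) {g : G} (hg : g ∈ MulAction.stabilizer G B)
    {n : ℕ} (hn : (fixingSubgroup G B).relIndex (MulAction.stabilizer G B) ∣ n) :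
    g ^ n ∈ fixingSubgroup G B := by
  have hnormal : ((fixingSubgroup G B).subgroupOf (MulAction.stabilizer G B)).Normal := by
    refine ⟨fun n hn k => ?_⟩
    rw [Subgroup.mem_subgroupOf, mem_fixingSubgroup_iff] at hn ⊢
    intro b hb
    have hk : (k : G)⁻¹ • b ∈ B := by
      have := MulAction.mem_stabilizer_iff.1 (inv_mem k.2)
      exact this.le (Set.smul_mem_smul_set hb)
    simp only [Subgroup.coe_mul, Subgroup.coe_inv, mul_smul]
    rw [hn _ hk, smul_inv_smul]
  obtain ⟨c, rfl⟩ := hn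
  rw [pow_mul]
  exact pow_mem (Subgroup.pow_index_mem
    ((fixingSubgroup G B).subgroupOf (MulAction.stabilizer G B)) ⟨g, hg⟩) c

/-- The element `g` permutes a finite set `B` whose pointwise stabilizer fixes all `t i`. On `B` its
order divides both `p` and a power of `m`, so `g` acts trivially there and fixes the tuple. -/
theorem isConstTuple_of_satisfiesIND (hG : IsOligomorphic G Ω) {m : ℕ}
    (hind : SatisfiesIND G Ω m) {p : ℕ} [hp : Fact p.Prime] (hpm : ¬ p ∣ m)
    {Y : Type u} [MulAction G Y] [hY : IsSmoothSet (pointStabilizerClass G Ω) Y]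
    (t : ZMod p → Y) (g : G) (c : ZMod p) (h : ∀ i, g • t i = t (i + c)) (hc : c ≠ 0) :
    IsConstTuple t := by
  choose A hA using fun i => hY.stabilizer_mem (t i)
  -- The chosen sets `A i` need not be permuted by `g`. The fixed points of the stabilizers depend
  -- only on `t i`, so `g` carries `F i` into `F (i + c)`.
  let F : ZMod p → Set Ω := fun i => {ω | ∀ k ∈ MulAction.stabilizer G (t i), k • ω = ω}
  have hF : ∀ i, (F i).Finite := fun i => by
    simp only [F, hA]
    exact hG.finite_fixedPoints (A i)
  have hfin : (⋃ i, F i).Finite := Set.finite_iUnion hF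
  let B := hfin.toFinset
  have hBF : (B : Set Ω) = ⋃ i, F i := hfin.coe_toFinset
  have hgB : g ∈ MulAction.stabilizer G (B : Set Ω) := by
    rw [MulAction.mem_stabilizer_set_iff_smul_set_subset B.finite_toSet, hBF]
    rintro _ ⟨ω, hω, rfl⟩
    obtain ⟨i, hi⟩ := Set.mem_iUnion.1 hω
    refine Set.mem_iUnion.2 ⟨i + c, fun k hk => ?_⟩
    have h1 : g⁻¹ * k * g ∈ MulAction.stabilizer G (t i) := by
      rw [MulAction.mem_stabilizer_iff] at hk ⊢
      rw [mul_smul, mul_smul, h, hk, ← h, inv_smul_smul]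
    have h2 := hi _ h1
    rwa [mul_smul, mul_smul, inv_smul_eq_iff] at h2
  have hpow : ∀ n : ℕ, ∀ i, g ^ n • t i = t (i + n * c) := by
    intro n
    induction n with
    | zero => simp
    | succ n ih =>
      intro i
      rw [pow_succ', mul_smul, ih, h]
      congr 1
      push_cast
      ring
  have hgp : g ^ p ∈ fixingSubgroup G (B : Set Ω) := by
    rw [mem_fixingSubgroup_iff, hBF]
    intro ω hω
    obtain ⟨i, hi⟩ := Set.mem_iUnion.1 hω
    exact hi _ (by rw [MulAction.mem_stabilizer_iff, hpow]; simp)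
  obtain ⟨k, hk⟩ := hind B
  have hgm := pow_index_mem_fixingSubgroup (B : Set Ω) hgB hk
  have hg : g ∈ fixingSubgroup G (B : Set Ω) := by
    -- Bézout for `p` and `m ^ k` writes `g` in terms of `g ^ p` and `g ^ (m ^ k)`.
    obtain ⟨a, b, hab⟩ := Nat.isCoprime_iff_coprime.2
      (((Nat.Prime.coprime_iff_not_dvd hp.out).2 hpm).pow_right k)
    rw [← zpow_one g, ← hab, zpow_add, mul_comm a, mul_comm b, zpow_mul, zpow_mul, zpow_natCast,
      zpow_natCast]
    exact mul_mem (zpow_mem hgp a) (zpow_mem hgm b)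
  refine isConstTuple_of_eq_add hc fun i => ?_
  have hgt : g ∈ MulAction.stabilizer G (t i) := by
    rw [hA i, mem_fixingSubgroup_iff]
    intro ω hω
    refine (mem_fixingSubgroup_iff G).1 hg ω ?_
    rw [hBF]
    refine Set.mem_iUnion.2 ⟨i, fun k hk => ?_⟩
    rw [hA i] at hk
    exact (mem_fixingSubgroup_iff G).1 hk ω hω
  rw [← h i]
  exact hgt.symm

end Oligomorphic

theorem theorem2p9 (G Ω : Type u) [Group G] [MulAction G Ω] [FaithfulSMul G Ω]
    (hG : IsOligomorphic G Ω) (m : ℕ) (hm : 0 < m) (hind : SatisfiesIND G Ω m) :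
    Nonempty (BinomialRing (Localization.Away (m : ThetaPerm G Ω))) := by
  have := hG.hasSmoothProducts
  have key : ∀ p : ℕ, p.Prime → ¬ p ∣ m → _ := fun p hp hpm =>
    have : Fact p.Prime := ⟨hp⟩
    theta_pow_sub_self_and_torsionFree (p := p) (pointStabilizerClass G Ω)
      fun _ => isConstTuple_of_satisfiesIND hG hind hpm
  exact nonempty_binomialRing_away m (fun p hp hpm => (key p hp hpm).2)
    fun p hp hpm => (key p hp hpm).1
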